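/- Let $d\ge 1$ and let $\Omega\subset\mathbb R^d$ be a bounded domain (nonempty, open, connected) whose boundary is a real-analytic hypersurface (near each of its points, $\Omega$ is the set where a real-analytic function with nowhere vanishing differential is negative). Let $a>0$, $b\in\mathbb R\setminus\{0\}$, $T>0$, let $0<\lambda_1\le\lambda_2\le\cdots$ be the eigenvalues of $-\Delta$ in $\Omega$ with zero Dirichlet boundary condition (eigenfunctions in $H_0^1(\Omega)$, equation in the weak sense), and let $\gamma\in\mathbb C$ satisfy $$\gamma\notin\bigcup_{k\in\mathbb Z,\;n\ge1}\Big\{a\lambda_n+i\Big(b\lambda_n-\frac{2k\pi}{T}\Big)\Big\}.$$ All function spaces consist of complex-valued functions. Equip $H^2(\Omega)\cap H_0^1(\Omega)=\mathcal D(-\Delta)$ with the norm $\|f\|_{H^2(\Omega)\cap H_0^1(\Omega)}:=\|\Delta f\|_{L^2(\Omega)}$, which is equivalent to the $H^2(\Omega)$-norm there (and bounded by $\sqrt d$ times it). Then for every $M>0$ there is a constant $C>0$, depending only on $a,b,d,\gamma,T,M,\Omega$, such that the following holds. Let $f\in H^2(\Omega)\cap H_0^1(\Omega)$ with $\|f\|_{H^2(\Omega)\cap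 H_0^1(\Omega)}\le M$, and let $u\in H^1(0,T;L^2(\Omega))\cap L^2(0,T;H^2(\Omega))$ solve $$\begin{cases}u_t-(a+ib)\Delta u=e^{-\gamma t}f(x), & (x,t)\in\Omega\times(0,T],\\ u=0, & (x,t)\in\partial\Omega\times(0,T],\\ u(x,0)=0, & x\in\Omega,\end{cases}$$ that is, the equation holds in $L^2(\Omega)$ and $u(\cdot,t)\in H_0^1(\Omega)$ for almost every $t\in(0,T)$, and the continuous representative $u\in C([0,T];L^2(\Omega))$ vanishes at $t=0$. Then $$\|f\|_{L^2(\Omega)}\le C\,M^{1/2}\,\|u(\cdot,T)\|_{L^2(\Omega)}^{1/2}.$$ -/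

import Mathlib

open MeasureTheory Filter Topology Set TopologicalSpace
open scoped ENNReal Distributions

noncomputable section

namespace CGLE

/-- The Euclidean space `ℝᵈ`. -/
abbrev Euc (d : ℕ) : Type := EuclideanSpace ℝ (Fin d)

/-- The boundary of the open set `Ω` is a real-analytic hypersurface: near every boundary point,
`Ω` is the set where a real-analytic function with nowhere vanishing differential is negative. -/
def HasAnalyticBoundary {d : ℕ} (Ω : Opens (Euc d)) : Prop :=
  ∀ p ∈ frontier (Ω : Set (Euc d)), ∃ (U : Set (Euc d)) (ρ : Euc d → ℝ),
    IsOpen U ∧ p ∈ U ∧ AnalyticOnNhd ℝ ρ U ∧ (∀ x ∈ U, fderiv ℝ ρ x ≠ 0) ∧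
      (Ω : Set (Euc d)) ∩ U = {x ∈ U | ρ x < 0}

/-- The complex Hilbert space `L²(Ω) = L²(Ω; ℂ)`. -/
abbrev L2 {d : ℕ} (Ω : Opens (Euc d)) : Type :=
  Lp ℂ 2 ((volume : Measure (Euc d)).restrict (Ω : Set (Euc d)))

/-- The classical partial derivative `∂ψ/∂xᵢ`. -/
def partialD {d : ℕ} (i : Fin d) (ψ : Euc d → ℂ) (x : Euc d) : ℂ :=
  fderiv ℝ ψ x (EuclideanSpace.single i (1 : ℝ))

/-- `g ∈ L²(Ω)` is the weak partial derivative `∂f/∂xᵢ` of `f ∈ L²(Ω)`. -/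
def IsWeakPartial {d : ℕ} (Ω : Opens (Euc d)) (i : Fin d) (f g : L2 Ω) : Prop :=
  ∀ ψ : 𝓓(Ω, ℂ),
    ∫ x in (Ω : Set (Euc d)), f x * partialD i ψ x = -∫ x in (Ω : Set (Euc d)), g x * ψ x

/-- Weak partial derivatives are unique. -/
theorem IsWeakPartial.unique {d : ℕ} {Ω : Opens (Euc d)} {i : Fin d} {f g h : L2 Ω}
    (hg : IsWeakPartial Ω i f g) (hh : IsWeakPartial Ω i f h) : g = h := by
  have key : ∀ᵐ x ∂(volume : Measure (Euc d)), x ∈ (Ω : Set (Euc d)) → g x - h x = 0 := by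
    apply Ω.isOpen.ae_eq_zero_of_integral_contDiff_smul_eq_zero
    · have h1 : LocallyIntegrable (fun x => g x - h x)
          ((volume : Measure (Euc d)).restrict (Ω : Set (Euc d))) :=
        ((Lp.memLp g).sub (Lp.memLp h)).locallyIntegrable (by norm_num)
      exact (locallyIntegrableOn_of_locallyIntegrable_restrict h1)
    · intro η h1 h2 h3
      have h4 : ContDiff ℝ (⊤ : ℕ∞) (fun x => (η x : ℂ)) :=
        Complex.ofRealCLM.contDiff.comp h1
      have h5 : HasCompactSupport (fun x => (η x : ℂ)) := h2.comp_left (g := fun y : ℝ => (y : ℂ)) (by simp)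
      have h6 : tsupport (fun x => (η x : ℂ)) ⊆ Ω :=
        (tsupport_comp_subset (g := fun y : ℝ => (y : ℂ)) (by simp) η).trans h3
      let ψ : 𝓓(Ω, ℂ) := ⟨fun x => (η x : ℂ), h4, h5, h6⟩
      have e := neg_injective ((hg ψ).symm.trans (hh ψ))
      have hm : MemLp ψ 2 ((volume : Measure (Euc d)).restrict (Ω : Set (Euc d))) :=
        (h4.continuous.memLp_of_hasCompactSupport h5).restrict _
      have i1 : Integrable (fun x => g x * ψ x) ((volume : Measure (Euc d)).restrict (Ω : Set (Euc d))) := (Lp.memLp g).integrable_mul hm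
      have i2 : Integrable (fun x => h x * ψ x) ((volume : Measure (Euc d)).restrict (Ω : Set (Euc d))) := (Lp.memLp h).integrable_mul hm
      have e2 := integral_sub i1 i2
      rw [e, sub_self] at e2
      rw [← e2, ← setIntegral_eq_integral_of_forall_compl_eq_zero (s := (Ω : Set (Euc d)))]
      · congr 1; ext x
        change (η x) • (g x - h x) = g x * (η x : ℂ) - h x * (η x : ℂ)
        rw [Complex.real_smul]; ring
      · intro x hx
        have : η x = 0 := by
          by_contra hne
          exact hx (h3 (subset_tsupport _ hne))
        simp [this]
  apply Lp.ext
  rw [Filter.EventuallyEq, ae_restrict_iff' Ω.isOpen.measurableSet]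
  filter_upwards [key] with x hx hxΩ
  exact sub_eq_zero.1 (hx hxΩ)

open Classical in
/-- The weak partial derivative `∂f/∂xᵢ` (zero if `f` has none in `L²(Ω)`). -/
def weakPartial {d : ℕ} (Ω : Opens (Euc d)) (i : Fin d) (f : L2 Ω) : L2 Ω :=
  if h : ∃ g : L2 Ω, IsWeakPartial Ω i f g then h.choose else 0

/-- The defining property of the chosen weak partial derivative. -/
theorem IsWeakPartial.eq {d : ℕ} {Ω : Opens (Euc d)} {i : Fin d} {f g : L2 Ω}
    (hg : IsWeakPartial Ω i f g) : weakPartial Ω i f = g := by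
  have h : ∃ g : L2 Ω, IsWeakPartial Ω i f g := ⟨g, hg⟩
  rw [weakPartial, dif_pos h]
  exact h.choose_spec.unique hg

/-- `f ∈ H¹(Ω)`. -/
def MemH1 {d : ℕ} (Ω : Opens (Euc d)) (f : L2 Ω) : Prop :=
  ∀ i : Fin d, ∃ g : L2 Ω, IsWeakPartial Ω i f g

/-- `f ∈ H²(Ω)`. -/
def MemH2 {d : ℕ} (Ω : Opens (Euc d)) (f : L2 Ω) : Prop :=
  MemH1 Ω f ∧ ∀ i : Fin d, MemH1 Ω (weakPartial Ω i f)

/-- `f ∈ H₀¹(Ω)`, the closure of `C_c^∞(Ω)` in `H¹(Ω)`. -/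
def MemH10 {d : ℕ} (Ω : Opens (Euc d)) (f : L2 Ω) : Prop :=
  MemH1 Ω f ∧ ∃ ψ : ℕ → 𝓓(Ω, ℂ),
    Tendsto (fun k => eLpNorm (fun x => ψ k x - f x) 2
      ((volume : Measure (Euc d)).restrict (Ω : Set (Euc d)))) atTop (𝓝 0) ∧
    ∀ i : Fin d, Tendsto (fun k => eLpNorm (fun x => partialD i (ψ k) x - weakPartial Ω i f x) 2
      ((volume : Measure (Euc d)).restrict (Ω : Set (Euc d)))) atTop (𝓝 0)

/-- The Laplacian `Δf = ∑ᵢ ∂²f/∂xᵢ²` of `f ∈ H²(Ω)`, in the sense of weak derivatives. -/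
def laplacian {d : ℕ} (Ω : Opens (Euc d)) (f : L2 Ω) : L2 Ω :=
  ∑ i : Fin d, weakPartial Ω i (weakPartial Ω i f)

/-- The norm `‖Δf‖_{L²(Ω)}` on `D(-Δ) = H²(Ω) ∩ H₀¹(Ω)`. -/
def normH2H10 {d : ℕ} (Ω : Opens (Euc d)) (f : L2 Ω) : ℝ := ‖laplacian Ω f‖

/-- `lam` is an eigenvalue of `-Δ` on `Ω` with zero Dirichlet boundary condition: there is a
nonzero `φ ∈ H₀¹(Ω)` with `-Δφ = lam φ` weakly. -/
def IsDirichletEigenvalue {d : ℕ} (Ω : Opens (Euc d)) (lam : ℝ) : Prop :=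
  ∃ φ : L2 Ω, φ ≠ 0 ∧ MemH10 Ω φ ∧ ∀ ψ : 𝓓(Ω, ℂ),
    ∑ i : Fin d, ∫ x in (Ω : Set (Euc d)), weakPartial Ω i φ x * partialD i ψ x
      = (lam : ℂ) * ∫ x in (Ω : Set (Euc d)), φ x * ψ x

/-- `u ∈ L²(0,T; L²(Ω))`. -/
def MemL2Time {d : ℕ} (Ω : Opens (Euc d)) (T : ℝ) (u : ℝ → L2 Ω) : Prop :=
  MemLp u 2 ((volume : Measure ℝ).restrict (Ioo 0 T))

/-- `u ∈ H¹(0,T; L²(Ω))` with time derivative `u_t = v`; `u` is the continuous representative, so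
that `u 0` and `u T` are the values of `u` at the times `0` and `T`. -/
def HasTimeDeriv {d : ℕ} (Ω : Opens (Euc d)) (T : ℝ) (u v : ℝ → L2 Ω) : Prop :=
  MemL2Time Ω T v ∧ ∀ t ∈ Icc 0 T, u t = u 0 + ∫ s in (0 : ℝ)..t, v s

/-- `u ∈ L²(0,T; H²(Ω))`. -/
def MemL2TimeH2 {d : ℕ} (Ω : Opens (Euc d)) (T : ℝ) (u : ℝ → L2 Ω) : Prop :=
  (∀ᵐ t ∂(volume : Measure ℝ).restrict (Ioo 0 T), MemH2 Ω (u t)) ∧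
  MemL2Time Ω T u ∧
  (∀ i : Fin d, MemL2Time Ω T (fun t => weakPartial Ω i (u t))) ∧
  (∀ i j : Fin d, MemL2Time Ω T (fun t => weakPartial Ω j (weakPartial Ω i (u t))))

/-- `u ∈ H¹(0,T; L²(Ω)) ∩ L²(0,T; H²(Ω))` solves `u_t - (a+ib)Δu = g(t) f(x)` in `Ω × (0,T]`,
`u = 0` on `∂Ω × (0,T]` and `u(·,0) = u₀` in `Ω`. -/
def IsSolution {d : ℕ} (Ω : Opens (Euc d)) (a b T : ℝ) (g : ℝ → ℂ) (f u₀ : L2 Ω)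
    (u : ℝ → L2 Ω) : Prop :=
  MemL2TimeH2 Ω T u ∧
  (∀ᵐ t ∂(volume : Measure ℝ).restrict (Ioo 0 T), MemH10 Ω (u t)) ∧
  u 0 = u₀ ∧
  ∃ v : ℝ → L2 Ω, HasTimeDeriv Ω T u v ∧
    ∀ᵐ t ∂(volume : Measure ℝ).restrict (Ioo 0 T),
      v t - ((a : ℂ) + (b : ℂ) * Complex.I) • laplacian Ω (u t) = g t • f

end CGLE

end

-- Expand everything along eigenvectors of the Dirichlet Laplacian. Let `e` be one, with eigenvalue
-- `λ`, and put `κ = (a + ib)λ`. The coefficient `c(t) = ⟨e, u(t)⟩` solves `c' + κc = e^{-γt}⟨e, f⟩`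
-- with `c(0) = 0`. Hence `⟨e, u(T)⟩ = D(κ)⟨e, f⟩`, where `D(κ) = (e^{-γT} - e^{-κT})/(κ - γ)`,
-- while `⟨e, Δf⟩ = -λ⟨e, f⟩`. Multiplying, `λ|D(κ)| |⟨e, f⟩|² = |⟨e, Δf⟩| |⟨e, u(T)⟩|`.
--
-- The crux is a lower bound `λ|D(κ)| ≥ c > 0` uniform in `λ` (`exists_le_mul_norm_duhamel`). As `λ
-- → ∞` the left side tends to `|e^{-γT}|/|a + ib|`, since `a > 0`. On the bounded part of the
-- spectrum it is continuous on a compact set and has no zero, because `e^{-κT} = e^{-γT}` is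
-- exactly the excluded resonance. Summing over a Hilbert basis with Cauchy–Schwarz and Bessel
-- (`norm_sq_le_of_forall_eigenvector`) gives `‖f‖² ≤ c⁻¹ ‖Δf‖ ‖u(T)‖`.
--
-- The eigenvectors come from the resolvent `(1 - Δ)⁻¹ = J J*`, where `J` embeds `H₀¹(Ω)` in
-- `L²(Ω)`. It is symmetric by construction and compact by Rellich's theorem; an eigenvalue `ν ≠ 0`
-- corresponds to `λ = ν⁻¹ - 1`, positive by the Poincaré inequality. No elliptic regularity is
-- needed: all that is used of the resolvent on `H² ∩ H₀¹` is `resolvent_sub_laplacian`, which is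
-- Green's formula.

universe u

noncomputable section

namespace CGLE

/-! ### Spectral theorem for compact self-adjoint operators -/

/-- An orthogonal family of closed subspaces with trivial joint orthogonal complement admits a
Hilbert basis consisting of elements of the members of the family. -/
theorem exists_hilbertBasis_of_orthogonalFamily {H : Type u} [NormedAddCommGroup H]
    [InnerProductSpace ℂ H] [CompleteSpace H] {J : Type} [DecidableEq J] (E : J → Submodule ℂ H)
    [∀ μ, CompleteSpace (E μ)] (hfam : OrthogonalFamily ℂ (fun μ => E μ) fun μ => (E μ).subtypeₗᵢ)
    (h0 : (⨆ μ, E μ)ᗮ = ⊥) :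
    ∃ (ι : Type u) (b : HilbertBasis ι ℂ H), ∀ i, ∃ μ, b i ∈ E μ := by
  have hex : ∀ μ, ∃ (w : Set (E μ)) (b : HilbertBasis w ℂ (E μ)), ⇑b = Subtype.val :=
    fun μ => exists_hilbertBasis ℂ _
  choose w b hb using hex
  have hon := hfam.orthonormal_sigma_orthonormal (α := fun μ => w μ) (v_family := fun μ => b μ)
    (fun μ => (b μ).orthonormal)
  -- Density via orthogonality: a vector orthogonal to all the chosen basis vectors is orthogonal to
  -- each `E μ`, since these vectors span a dense subspace of `E μ`, and so it vanishes by `h0`.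
  have hdense : ⊤ ≤ (Submodule.span ℂ (Set.range
      fun a : Σ μ, w μ => (E a.1).subtypeₗᵢ (b a.1 a.2))).topologicalClosure := by
    rw [top_le_iff, Submodule.topologicalClosure_eq_top_iff, eq_bot_iff, ← h0]
    refine fun x hx => (Submodule.mem_orthogonal _ _).2 fun y hy => ?_
    have hle : (⨆ μ, E μ) ≤ (ℂ ∙ x)ᗮ := by
      refine iSup_le fun μ z hz => ?_
      rw [Submodule.mem_orthogonal_singleton_iff_inner_left]
      have hz' : (⟨z, hz⟩ : E μ) ∈ (Submodule.span ℂ (Set.range (b μ))).topologicalClosure := by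
        rw [(b μ).dense_span]; trivial
      have hcl : IsClosed {z : E μ | inner ℂ (z : H) x = 0} :=
        isClosed_eq (by fun_prop) continuous_const
      refine closure_minimal ?_ hcl hz'
      intro t ht
      refine Submodule.span_induction ?_ ?_ ?_ ?_ ht
      · rintro _ ⟨a, rfl⟩
        exact (Submodule.mem_orthogonal _ _).1 hx _ (Submodule.subset_span ⟨⟨μ, a⟩, rfl⟩)
      · exact inner_zero_left x
      · intro s t _ _ hs' ht'
        rw [mem_ofPred_eq] at *
        rw [Submodule.coe_add, inner_add_left, hs', ht', add_zero]
      · intro k t _ ht'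
        rw [mem_ofPred_eq] at *
        rw [Submodule.coe_smul, inner_smul_left, ht', mul_zero]
    exact (Submodule.mem_orthogonal_singleton_iff_inner_left.1 (hle hy))
  refine ⟨_, HilbertBasis.mk hon hdense, fun i => ⟨i.1, ?_⟩⟩
  rw [HilbertBasis.coe_mk]
  exact (b i.1 i.2).2

/-- A compact self-adjoint operator on a complex Hilbert space has a Hilbert basis of
eigenvectors. -/
theorem exists_hilbertBasis_eigenvectors {H : Type u} [NormedAddCommGroup H]
    [InnerProductSpace ℂ H] [CompleteSpace H] (G : H →L[ℂ] H) (hc : IsCompactOperator G)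
    (hs : (G : H →ₗ[ℂ] H).IsSymmetric) :
    ∃ (ι : Type u) (b : HilbertBasis ι ℂ H), ∀ i, ∃ μ : ℝ, G (b i) = (μ : ℂ) • b i := by
  have hcomplete : ∀ μ : ℂ, CompleteSpace (Module.End.eigenspace (G : H →ₗ[ℂ] H) μ) := by
    intro μ
    have hcl : IsClosed (Module.End.eigenspace (G : H →ₗ[ℂ] H) μ : Set H) := by
      have : (Module.End.eigenspace (G : H →ₗ[ℂ] H) μ : Set H) = {x | G x = μ • x} := by
        ext x; simp
      rw [this]
      exact isClosed_eq G.continuous (continuous_const_smul μ)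
    exact hcl.completeSpace_coe
  obtain ⟨ι, b, hb⟩ := exists_hilbertBasis_of_orthogonalFamily
    (fun μ : ℂ => Module.End.eigenspace (G : H →ₗ[ℂ] H) μ) hs.orthogonalFamily_eigenspaces
    (ContinuousLinearMap.orthogonalComplement_iSup_eigenspaces_eq_bot hc hs)
  refine ⟨ι, b, fun i => ?_⟩
  obtain ⟨μ, hmem⟩ := hb i
  have hev : Module.End.HasEigenvalue (G : H →ₗ[ℂ] H) μ :=
    Module.End.hasEigenvalue_of_hasEigenvector ⟨hmem, b.orthonormal.ne_zero i⟩
  refine ⟨μ.re, ?_⟩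
  rw [Complex.conj_eq_iff_re.1 (hs.conj_eigenvalue_eq_self hev)]
  exact Module.End.mem_eigenspace_iff.1 hmem

/-- An interpolation-type inequality which holds on each eigenvector of a compact self-adjoint
operator holds on the whole space. -/
theorem norm_sq_le_of_forall_eigenvector {H : Type*} [NormedAddCommGroup H]
    [InnerProductSpace ℂ H] [CompleteSpace H] (G : H →L[ℂ] H) (hc : IsCompactOperator G)
    (hs : (G : H →ₗ[ℂ] H).IsSymmetric) {f g w : H} {C : ℝ} (hC : 0 ≤ C)
    (h : ∀ (e : H) (μ : ℝ), e ≠ 0 → G e = (μ : ℂ) • e →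
      ‖inner ℂ e f‖ ^ 2 ≤ C * (‖inner ℂ e g‖ * ‖inner ℂ e w‖)) :
    ‖f‖ ^ 2 ≤ C * (‖g‖ * ‖w‖) := by
  obtain ⟨ι, b, hb⟩ := exists_hilbertBasis_eigenvectors G hc hs
  have hsum : HasSum (fun i => ‖inner ℂ (b i) f‖ ^ 2) (‖f‖ ^ 2) := by
    have h1 := b.hasSum_inner_mul_inner f f
    have h2 := Complex.hasSum_re h1
    convert h2 using 2 with i
    · rw [← inner_conj_symm f (b i), mul_comm, Complex.mul_conj, Complex.normSq_eq_norm_sq,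
        Complex.ofReal_re]
    · rw [inner_self_eq_norm_sq_to_K]
      norm_cast
  -- Parseval for `f` reduces the claim to finite sums, where Cauchy–Schwarz and Bessel's inequality
  -- for `g` and `w` suffice.
  refine hasSum_le_of_sum_le hsum fun s => ?_
  calc ∑ i ∈ s, ‖inner ℂ (b i) f‖ ^ 2
      ≤ ∑ i ∈ s, C * (‖inner ℂ (b i) g‖ * ‖inner ℂ (b i) w‖) := by
        refine Finset.sum_le_sum fun i _ => ?_
        obtain ⟨μ, hμ⟩ := hb i
        exact h _ μ (b.orthonormal.ne_zero i) hμ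
    _ = C * ∑ i ∈ s, ‖inner ℂ (b i) g‖ * ‖inner ℂ (b i) w‖ := by rw [Finset.mul_sum]
    _ ≤ C * (‖g‖ * ‖w‖) := by
        refine mul_le_mul_of_nonneg_left ?_ hC
        refine (Real.sum_mul_le_sqrt_mul_sqrt _ _ _).trans ?_
        refine mul_le_mul ?_ ?_ (Real.sqrt_nonneg _) (norm_nonneg _)
        · exact Real.sqrt_le_iff.2 ⟨norm_nonneg _, b.orthonormal.sum_inner_products_le g⟩
        · exact Real.sqrt_le_iff.2 ⟨norm_nonneg _, b.orthonormal.sum_inner_products_le w⟩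

/-! ### The scalar equation, non-resonance, compactness of sets of eigenvalues -/

/-- The Duhamel factor `∫₀ᵀ e^{-κ(T-s)} e^{-γs} ds` for `κ ≠ γ`. -/
def duhamel (T : ℝ) (γ κ : ℂ) : ℂ :=
  (Complex.exp (-γ * T) - Complex.exp (-κ * T)) / (κ - γ)

/-- The terminal value of the scalar equation `c' + κ c = e^{-γt} F`, `c(0) = 0`, understood in the
integrated sense. -/
theorem eq_duhamel_mul {T : ℝ} (hT : 0 < T) {γ κ F : ℂ} (hκ : κ ≠ γ) {c w : ℝ → ℂ}
    (hw : IntervalIntegrable w volume 0 T) (hcw : ∀ t ∈ Icc 0 T, c t = ∫ s in (0 : ℝ)..t, w s)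
    (heq : ∀ᵐ t ∂(volume : Measure ℝ).restrict (Ioo 0 T),
      w t + κ * c t = Complex.exp (-γ * (t : ℂ)) * F) :
    c T = duhamel T γ κ * F := by
  have hcont : ContinuousOn c (Icc 0 T) := by
    have h1 : ContinuousOn (fun t => ∫ s in (0 : ℝ)..t, w s) (Icc 0 T) := by
      have := intervalIntegral.continuousOn_primitive_interval' (μ := volume) (f := w) (a := 0)
        (b₁ := 0) (b₂ := T) hw (by simp)
      rwa [uIcc_of_le hT.le] at this
    exact h1.congr hcw
  -- Extending `c` by constants beyond `[0, T]` makes the integrand `q` continuous on the whole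
  -- line, so its primitive is differentiable everywhere and the a.e. equation becomes a classical
  -- one.
  let c' : ℝ → ℂ := IccExtend hT.le ((Icc 0 T).domRestrict c)
  have hc' : Continuous c' := hcont.domRestrict.Icc_extend'
  have hcc : ∀ t ∈ Icc 0 T, c' t = c t := fun t ht => IccExtend_of_mem hT.le _ ht
  let q : ℝ → ℂ := fun s => Complex.exp (-γ * (s : ℂ)) * F - κ * c' s
  have hq : Continuous q := by fun_prop
  have hcq : ∀ t ∈ Icc 0 T, c t = ∫ s in (0 : ℝ)..t, q s := by
    intro t ht
    rw [hcw t ht]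
    refine intervalIntegral.integral_congr_ae ?_
    -- The equation is known only on the open interval, so the endpoint `T` is discarded as a null
    -- set.
    have h2 : ∀ᵐ s : ℝ, s ≠ T := by simp [ae_iff, measure_singleton]
    rw [ae_restrict_iff' measurableSet_Ioo] at heq
    filter_upwards [heq, h2] with s hs hsT hst
    rw [uIoc_of_le ht.1] at hst
    have hs' := hs ⟨hst.1, lt_of_le_of_ne (hst.2.trans ht.2) hsT⟩
    simp only [q]
    rw [hcc s ⟨hst.1.le, hst.2.trans ht.2⟩, ← hs']
    ring
  let Q : ℝ → ℂ := fun t => ∫ s in (0 : ℝ)..t, q s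
  have hQ : ∀ t, HasDerivAt Q (q t) t := fun t => hq.integral_hasStrictDerivAt 0 t |>.hasDerivAt
  have hne : κ - γ ≠ 0 := sub_ne_zero.2 hκ
  -- Integrating factor `e^{κt}`: `y` is the difference of the two sides of the solution formula, up
  -- to a constant, so its derivative vanishes.
  let y : ℝ → ℂ := fun t => Complex.exp (κ * t) * Q t -
    F * Complex.exp ((κ - γ) * t) / (κ - γ)
  have hexp : ∀ (z : ℂ) (t : ℝ), HasDerivAt (fun t : ℝ => Complex.exp (z * t))
      (Complex.exp (z * t) * z) t := fun z t => by
    have := (((hasDerivAt_id t).ofReal_comp).const_mul z).cexp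
    simpa using this
  have hy : ∀ t ∈ Icc 0 T, HasDerivAt y 0 t := by
    intro t ht
    have h1 := ((hexp κ t).mul (hQ t)).sub (((hexp (κ - γ) t).const_mul F).div_const (κ - γ))
    refine HasDerivAt.congr_deriv h1 ?_
    have h3 : Q t = c' t := by rw [hcc t ht, hcq t ht]
    have h4 : Complex.exp ((κ - γ) * t) = Complex.exp (κ * t) * Complex.exp (-γ * t) := by
      rw [← Complex.exp_add]; ring_nf
    have h5 : q t = Complex.exp (-γ * t) * F - κ * c' t := rfl
    rw [h3, h4, h5]
    field_simp
    ring
  have hyc : y T = y 0 := by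
    refine constant_of_has_deriv_right_zero (fun t ht => (hy t ht).continuousAt.continuousWithinAt)
      (fun t ht => (hy t (Ico_subset_Icc_self ht)).hasDerivWithinAt) T ⟨hT.le, le_rfl⟩
  have hQ0 : Q 0 = 0 := by simp [Q]
  have hQT : Q T = c T := (hcq T ⟨hT.le, le_rfl⟩).symm
  simp only [y, hQ0, hQT, Complex.ofReal_zero, mul_zero, zero_sub, Complex.exp_zero, mul_one]
    at hyc
  have h5 : Complex.exp (κ * T) * Complex.exp (-κ * T) = 1 := by
    rw [← Complex.exp_add]; ring_nf; simp
  have h6 : Complex.exp ((κ - γ) * T) * Complex.exp (-κ * T) = Complex.exp (-γ * T) := by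
    rw [← Complex.exp_add]; ring_nf
  have h7 : Complex.exp (κ * T) * c T =
      F * Complex.exp ((κ - γ) * T) / (κ - γ) - F / (κ - γ) := by
    linear_combination hyc
  calc c T = (Complex.exp (κ * T) * c T) * Complex.exp (-κ * T) := by
        linear_combination (-c T) * h5
    _ = duhamel T γ κ * F := by
        rw [h7, duhamel, ← h6]
        field_simp

/-- If `γ` is not resonant with the spectrum `S`, the Duhamel factors of `(a + ib)λ` are bounded
below by a multiple of `λ⁻¹` for `λ ∈ S`. -/
theorem exists_le_mul_norm_duhamel {a b T : ℝ} (ha : 0 < a) (hT : 0 < T) {γ : ℂ} {S : Set ℝ}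
    (hpos : ∀ lam ∈ S, 0 < lam) (hS : ∀ L : ℝ, IsCompact (S ∩ Iic L))
    (hγ : ∀ lam ∈ S, ∀ k : ℤ, γ ≠ (a : ℂ) * (lam : ℂ)
        + Complex.I * ((b : ℂ) * (lam : ℂ) - 2 * (k : ℂ) * (Real.pi : ℂ) / (T : ℂ))) :
    ∃ c : ℝ, 0 < c ∧ ∀ lam ∈ S, c ≤ lam * ‖duhamel T γ (((a : ℂ) + b * Complex.I) * lam)‖ := by
  set α : ℂ := (a : ℂ) + b * Complex.I with hα
  have hαre : α.re = a := by simp [hα]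
  have hα0 : α ≠ 0 := fun h => by rw [h] at hαre; simp at hαre; linarith
  have hTC : (T : ℂ) ≠ 0 := by exact_mod_cast hT.ne'
  -- The denominator of the Duhamel factor is controlled by the case `k = 0` of non-resonance; the
  -- numerator, by all `k` together through the periodicity of `exp`.
  have hne : ∀ lam ∈ S, α * lam - γ ≠ 0 := by
    intro lam hl h
    refine hγ lam hl 0 ?_
    simp only [hα] at h
    simp
    linear_combination -h
  have hne2 : ∀ lam ∈ S, Complex.exp (-γ * T) - Complex.exp (-(α * lam) * T) ≠ 0 := by
    intro lam hl h
    obtain ⟨k, hk⟩ := Complex.exp_eq_exp_iff_exists_int.1 (sub_eq_zero.1 h)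
    refine hγ lam hl k ?_
    rw [mul_sub, mul_div_assoc', eq_comm]
    have : γ = α * lam - k * (2 * Real.pi * Complex.I) / T := by
      field_simp
      linear_combination -hk
    rw [this, hα]
    field_simp
    ring
  have hlim : Tendsto (fun lam : ℝ => lam * ‖duhamel T γ (α * lam)‖) atTop
      (𝓝 (‖Complex.exp (-γ * T)‖ / ‖α‖)) := by
    have h1 : Tendsto (fun lam : ℝ => Complex.exp (-(α * lam) * T)) atTop (𝓝 0) := by
      rw [tendsto_zero_iff_norm_tendsto_zero]
      have : (fun lam : ℝ => ‖Complex.exp (-(α * lam) * T)‖) =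
          fun lam : ℝ => Real.exp (-((a * T) * lam)) := by
        funext lam
        rw [Complex.norm_exp]
        congr 1
        simp [hα]
        ring
      rw [this]
      exact Real.tendsto_exp_neg_atTop_nhds_zero.comp
        (tendsto_id.const_mul_atTop (mul_pos ha hT))
    -- The factor `lam` is absorbed into the denominator: `lam / (α lam - γ) = 1 / (α - γ / lam)`.
    have h2 : Tendsto (fun lam : ℝ => α - γ * ((lam⁻¹ : ℝ) : ℂ)) atTop (𝓝 (α - γ * ((0 : ℝ) : ℂ))) :=
      tendsto_const_nhds.sub (tendsto_const_nhds.mul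
        ((Complex.continuous_ofReal.tendsto _).comp tendsto_inv_atTop_zero))
    have h3 := ((tendsto_const_nhds (x := Complex.exp (-γ * T))).sub h1).div h2
      (by simpa using hα0)
    have h4 := h3.norm
    simp only [sub_zero, Complex.ofReal_zero, mul_zero, norm_div] at h4
    refine h4.congr' ?_
    filter_upwards [eventually_gt_atTop 0] with lam hl
    have hlC : (lam : ℂ) ≠ 0 := by exact_mod_cast hl.ne'
    rw [duhamel, norm_div]
    have h5 : α - γ * ((lam⁻¹ : ℝ) : ℂ) = (α * lam - γ) * ((lam : ℂ))⁻¹ := by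
      push_cast
      field_simp
    simp only [Pi.div_apply, norm_div]
    rw [h5, norm_mul, norm_inv, Complex.norm_real, Real.norm_of_nonneg hl.le]
    rw [div_eq_mul_inv, mul_inv, inv_inv, div_eq_mul_inv]
    ring
  set c₁ : ℝ := ‖Complex.exp (-γ * T)‖ / ‖α‖ with hc₁
  have hc₁pos : 0 < c₁ := div_pos (norm_pos_iff.2 (Complex.exp_ne_zero _)) (norm_pos_iff.2 hα0)
  -- Beyond `L` the quantity exceeds half its limit; below `L` it attains a positive minimum, unless
  -- `S` has no points there.
  obtain ⟨L, hL⟩ := eventually_atTop.1 (hlim.eventually (lt_mem_nhds (half_lt_self hc₁pos)))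
  have hcont : ContinuousOn (fun lam : ℝ => lam * ‖duhamel T γ (α * lam)‖) (S ∩ Iic L) := by
    refine continuousOn_id.mul (ContinuousOn.norm ?_)
    unfold duhamel
    exact ContinuousOn.div (by fun_prop) (by fun_prop) fun lam hl => hne lam hl.1
  rcases (S ∩ Iic L).eq_empty_or_nonempty with hempty | hnonempty
  · refine ⟨c₁ / 2, half_pos hc₁pos, fun lam hl => (hL lam ?_).le⟩
    by_contra! hlt
    exact (hempty ▸ (⟨hl, hlt.le⟩ : lam ∈ S ∩ Iic L) : lam ∈ (∅ : Set ℝ))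
  · obtain ⟨l₀, hl₀, hmin⟩ := (hS L).exists_isMinOn hnonempty hcont
    have hp : 0 < l₀ * ‖duhamel T γ (α * l₀)‖ :=
      mul_pos (hpos _ hl₀.1) (norm_pos_iff.2 (div_ne_zero (hne2 _ hl₀.1) (hne _ hl₀.1)))
    refine ⟨min (c₁ / 2) (l₀ * ‖duhamel T γ (α * l₀)‖), lt_min (half_pos hc₁pos) hp, ?_⟩
    intro lam hl
    rcases le_total lam L with h | h
    · exact (min_le_right _ _).trans (hmin ⟨hl, h⟩)
    · exact (min_le_left _ _).trans (hL lam h).le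

/-- The nonzero part of the spectrum of a compact self-adjoint operator is given by real
eigenvalues, so the real eigenvalues in `[r, s]`, `r > 0`, form a compact set. -/
theorem isCompact_eigenvalues_Icc {H : Type*} [NormedAddCommGroup H]
    [InnerProductSpace ℂ H] [CompleteSpace H] (G : H →L[ℂ] H) (hc : IsCompactOperator G)
    {r s : ℝ} (hr : 0 < r) :
    IsCompact {ν : ℝ | ν ∈ Icc r s ∧ ∃ e : H, e ≠ 0 ∧ G e = (ν : ℂ) • e} := by
  have : {ν : ℝ | ν ∈ Icc r s ∧ ∃ e : H, e ≠ 0 ∧ G e = (ν : ℂ) • e} =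
      Icc r s ∩ ((fun ν : ℝ => (ν : ℂ)) ⁻¹' spectrum ℂ G) := by
    ext ν
    simp only [mem_ofPred_eq, mem_inter_iff, mem_preimage]
    refine and_congr_right fun hν => ?_
    have hν0 : (ν : ℂ) ≠ 0 := by exact_mod_cast (hr.trans_le hν.1).ne'
    rw [← hc.hasEigenvalue_iff_mem_spectrum hν0]
    constructor
    · rintro ⟨e, he, hGe⟩
      exact Module.End.hasEigenvalue_of_hasEigenvector
        ⟨Module.End.mem_eigenspace_iff.2 hGe, he⟩
    · intro h
      obtain ⟨e, he⟩ := h.exists_hasEigenvector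
      exact ⟨e, he.2, Module.End.mem_eigenspace_iff.1 he.1⟩
  rw [this]
  exact isCompact_Icc.inter_right ((spectrum.isClosed G).preimage Complex.continuous_ofReal)

/-! ### Translation estimate and Poincaré inequality for test functions -/

theorem sq_lintegral_le {α : Type*} [MeasurableSpace α] (μ : Measure α) {f : α → ℝ≥0∞}
    (hf : AEMeasurable f μ) : (∫⁻ x, f x ∂μ) ^ 2 ≤ μ univ * ∫⁻ x, f x ^ 2 ∂μ := by
  have h := ENNReal.lintegral_mul_le_Lp_mul_Lq μ Real.HolderConjugate.two_two hf
    (aemeasurable_const (b := (1 : ℝ≥0∞)))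
  simp only [Pi.mul_apply, mul_one, ENNReal.one_rpow, lintegral_one] at h
  calc (∫⁻ x, f x ∂μ) ^ 2
      ≤ ((∫⁻ x, f x ^ (2 : ℝ) ∂μ) ^ (1 / 2 : ℝ) * μ univ ^ (1 / 2 : ℝ)) ^ 2 := by gcongr
    _ = μ univ * ∫⁻ x, f x ^ 2 ∂μ := by
        rw [mul_pow, ← ENNReal.rpow_natCast, ← ENNReal.rpow_natCast, ← ENNReal.rpow_mul,
          ← ENNReal.rpow_mul]
        norm_num
        rw [mul_comm]

variable {d : ℕ}

/-- The Dirichlet energy `∫ ‖Dψ‖²`. -/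
def energy (ψ : Euc d → ℂ) : ℝ≥0∞ := ∫⁻ x, ‖fderiv ℝ ψ x‖ₑ ^ 2

/-- Fundamental theorem of calculus along the segment from `x` to `x + h`, then Cauchy–Schwarz on an
interval of length one. -/
theorem enorm_sub_sq_le_lintegral {ψ : Euc d → ℂ} (hψ : ContDiff ℝ 1 ψ) (x h : Euc d) :
    ‖ψ (x + h) - ψ x‖ₑ ^ 2 ≤
      ‖h‖ₑ ^ 2 * ∫⁻ s in Ioc (0 : ℝ) 1, ‖fderiv ℝ ψ (x + s • h)‖ₑ ^ 2 := by
  have hd : Continuous (fun s : ℝ => fderiv ℝ ψ (x + s • h)) :=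
    (hψ.continuous_fderiv one_ne_zero).comp (by fun_prop)
  have hft : ∫ s in (0 : ℝ)..1, fderiv ℝ ψ (x + s • h) h = ψ (x + h) - ψ x := by
    have hda : ∀ s : ℝ, HasDerivAt (fun s : ℝ => ψ (x + s • h)) (fderiv ℝ ψ (x + s • h) h) s := by
      intro s
      have h1 : HasDerivAt (fun s : ℝ => x + s • h) h s := by
        simpa using ((hasDerivAt_id s).smul_const h).const_add x
      exact ((hψ.differentiable one_ne_zero) _).hasFDerivAt.comp_hasDerivAt s h1
    rw [intervalIntegral.integral_eq_sub_of_hasDerivAt (fun s _ => hda s)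
      ((hd.clm_apply continuous_const).intervalIntegrable _ _)]
    simp
  calc ‖ψ (x + h) - ψ x‖ₑ ^ 2
      ≤ (∫⁻ s in Ioc (0 : ℝ) 1, ‖fderiv ℝ ψ (x + s • h) h‖ₑ) ^ 2 := by
        rw [← hft, intervalIntegral.integral_of_le zero_le_one]
        gcongr
        exact enorm_integral_le_lintegral_enorm _
    _ ≤ volume.restrict (Ioc (0 : ℝ) 1) univ *
          ∫⁻ s in Ioc (0 : ℝ) 1, ‖fderiv ℝ ψ (x + s • h) h‖ₑ ^ 2 :=
        sq_lintegral_le _ (hd.clm_apply continuous_const).enorm.measurable.aemeasurable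
    _ ≤ ∫⁻ s in Ioc (0 : ℝ) 1, ‖h‖ₑ ^ 2 * ‖fderiv ℝ ψ (x + s • h)‖ₑ ^ 2 := by
        simp only [Measure.restrict_apply_univ, Real.volume_Ioc, sub_zero, ENNReal.ofReal_one,
          one_mul]
        refine lintegral_mono fun s => ?_
        rw [← mul_pow, mul_comm]
        gcongr
        exact ContinuousLinearMap.le_opENorm _ _
    _ = _ := lintegral_const_mul _ (hd.enorm.measurable.pow_const 2)

/-- The translation estimate `‖ψ(· + h) - ψ‖₂ ≤ |h| ‖Dψ‖₂`. -/
theorem lintegral_enorm_translate_sub_sq_le {ψ : Euc d → ℂ} (hψ : ContDiff ℝ 1 ψ) (h : Euc d) :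
    ∫⁻ x, ‖ψ (x + h) - ψ x‖ₑ ^ 2 ≤ ‖h‖ₑ ^ 2 * energy ψ := by
  have hd : Continuous (fun p : Euc d × ℝ => fderiv ℝ ψ (p.1 + p.2 • h)) :=
    (hψ.continuous_fderiv one_ne_zero).comp (by fun_prop)
  calc ∫⁻ x, ‖ψ (x + h) - ψ x‖ₑ ^ 2
      ≤ ∫⁻ x, ‖h‖ₑ ^ 2 * ∫⁻ s in Ioc (0 : ℝ) 1, ‖fderiv ℝ ψ (x + s • h)‖ₑ ^ 2 :=
        lintegral_mono fun x => enorm_sub_sq_le_lintegral hψ x h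
    _ = ‖h‖ₑ ^ 2 * ∫⁻ x, ∫⁻ s in Ioc (0 : ℝ) 1, ‖fderiv ℝ ψ (x + s • h)‖ₑ ^ 2 := by
        rw [lintegral_const_mul]
        exact (hd.enorm.measurable.pow_const 2).lintegral_prod_right'
    _ = ‖h‖ₑ ^ 2 * ∫⁻ s in Ioc (0 : ℝ) 1, ∫⁻ x, ‖fderiv ℝ ψ (x + s • h)‖ₑ ^ 2 := by
        rw [lintegral_lintegral_swap]
        exact (hd.enorm.measurable.pow_const 2).aemeasurable
    _ = ‖h‖ₑ ^ 2 * energy ψ := by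
        simp_rw [lintegral_add_right_eq_self (fun x => ‖fderiv ℝ ψ x‖ₑ ^ 2)]
        simp [energy]

/-- The Poincaré inequality for test functions on a bounded open set. -/
theorem exists_poincare (hd : 1 ≤ d) (Ω : Opens (Euc d))
    (hbdd : Bornology.IsBounded (Ω : Set (Euc d))) :
    ∃ C : ℝ, ∀ ψ : 𝓓(Ω, ℂ), ∫⁻ x, ‖ψ x‖ₑ ^ 2 ≤ ENNReal.ofReal C * energy ψ := by
  obtain ⟨R, hR⟩ := Metric.isBounded_iff.1 hbdd
  -- The shift is longer than the diameter bound `R`, so it carries every point of `Ω` outside `Ω`,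
  -- where `ψ` vanishes. The translation estimate then bounds `ψ` itself.
  let h : Euc d := EuclideanSpace.single ⟨0, hd⟩ (|R| + 1)
  have hh : ‖h‖ = |R| + 1 := by
    simp only [h, PiLp.norm_single, Real.norm_eq_abs]
    exact abs_of_pos (by positivity)
  refine ⟨‖h‖ ^ 2, fun ψ => ?_⟩
  have hoff : ∀ x, x ∉ (Ω : Set (Euc d)) → ψ x = 0 := fun x hx => by
    by_contra hne
    exact hx (ψ.tsupport_subset (subset_tsupport _ hne))
  calc ∫⁻ x, ‖ψ x‖ₑ ^ 2 ≤ ∫⁻ x, ‖ψ (x + h) - ψ x‖ₑ ^ 2 := by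
        refine lintegral_mono fun x => ?_
        by_cases hx : x ∈ (Ω : Set (Euc d))
        · have hxh : x + h ∉ (Ω : Set (Euc d)) := fun hxh => by
            have := hR hxh hx
            rw [dist_eq_norm, add_sub_cancel_left, hh] at this
            linarith [le_abs_self R]
          dsimp only
          rw [hoff _ hxh, zero_sub, enorm_neg]
        · simp [hoff x hx]
    _ ≤ ‖h‖ₑ ^ 2 * energy ψ :=
        lintegral_enorm_translate_sub_sq_le (ψ.contDiff.of_le (by exact_mod_cast le_top)) h
    _ = _ := by rw [ENNReal.ofReal_pow (norm_nonneg _), ofReal_norm]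

/-! ### Approximation by means over grid cells -/

/-- The half-open cell of the grid of mesh `ε` with index `k`. -/
def cell (ε : ℝ) (k : Fin d → ℤ) : Set (Euc d) := {x | ∀ i, x i ∈ Ico (ε * k i) (ε * k i + ε)}

theorem measurableSet_cell (ε : ℝ) (k : Fin d → ℤ) : MeasurableSet (cell ε k) := by
  have : cell ε k = ⋂ i, (fun x : Euc d => x i) ⁻¹' (Ico (ε * k i) (ε * k i + ε)) := by
    ext x; simp [cell]
  rw [this]
  exact MeasurableSet.iInter fun i => measurableSet_Ico.preimage (by fun_prop)

theorem volume_cell (ε : ℝ) (k : Fin d → ℤ) :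
    volume (cell ε k) = ENNReal.ofReal ε ^ d := by
  have : cell ε k = (@WithLp.ofLp 2 (Fin d → ℝ)) ⁻¹'
      (univ.pi fun i => Ico (ε * k i) (ε * k i + ε)) := by
    ext x; simp [cell]
  rw [this, (PiLp.volume_preserving_ofLp (Fin d)).measure_preimage
    (MeasurableSet.univ_pi fun i => measurableSet_Ico).nullMeasurableSet, Real.volume_pi_Ico]
  simp

/-- The closed cube of half-side `ε` centred at the origin. -/
def cube (d : ℕ) (ε : ℝ) : Set (Euc d) := {x | ∀ i, x i ∈ Icc (-ε) ε}

theorem measurableSet_cube (ε : ℝ) : MeasurableSet (cube d ε) := by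
  have : cube d ε = ⋂ i, (fun x : Euc d => x i) ⁻¹' (Icc (-ε) ε) := by
    ext x; simp [cube]
  rw [this]
  exact MeasurableSet.iInter fun i => measurableSet_Icc.preimage (by fun_prop)

theorem volume_cube (ε : ℝ) : volume (cube d ε) = ENNReal.ofReal (2 * ε) ^ d := by
  have : cube d ε = (@WithLp.ofLp 2 (Fin d → ℝ)) ⁻¹' (univ.pi fun _ => Icc (-ε) ε) := by
    ext x; simp only [cube, mem_preimage, Set.mem_pi, mem_univ, true_imp_iff, mem_ofPred_eq]
  rw [this, (PiLp.volume_preserving_ofLp (Fin d)).measure_preimage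
    (MeasurableSet.univ_pi fun i => measurableSet_Icc).nullMeasurableSet, volume_pi_pi]
  simp only [Real.volume_Icc, Finset.prod_const, Finset.card_univ, Fintype.card_fin]
  congr 2
  ring

theorem norm_sq_le_of_mem_cube {ε : ℝ} {h : Euc d} (hh : h ∈ cube d ε) :
    ‖h‖ ^ 2 ≤ d * ε ^ 2 := by
  rw [EuclideanSpace.norm_sq_eq]
  calc ∑ i, ‖h i‖ ^ 2 ≤ ∑ _i : Fin d, ε ^ 2 := by
        refine Finset.sum_le_sum fun i _ => ?_
        rw [Real.norm_eq_abs, sq_abs]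
        exact sq_le_sq' (hh i).1 (hh i).2
    _ = d * ε ^ 2 := by simp

/-- The index of the cell of mesh `ε` containing `x`. -/
def cellIndex (ε : ℝ) (x : Euc d) : Fin d → ℤ := fun i => ⌊x i / ε⌋

theorem mem_cell_iff {ε : ℝ} (hε : 0 < ε) {x : Euc d} {k : Fin d → ℤ} :
    x ∈ cell ε k ↔ k = cellIndex ε x := by
  have : ∀ i, x i ∈ Ico (ε * k i) (ε * k i + ε) ↔ k i = cellIndex ε x i := by
    intro i
    rw [cellIndex, eq_comm, Int.floor_eq_iff, le_div_iff₀ hε, div_lt_iff₀ hε, mem_Ico]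
    ring_nf
  rw [funext_iff]
  exact forall_congr' this

/-- The deviation of `ψ` from its mean over the cell containing `x`. -/
theorem enorm_sub_average_cell_sq_le {ε : ℝ} (hε : 0 < ε) {ψ : Euc d → ℂ} (hψ : Continuous ψ)
    (hc : HasCompactSupport ψ) {x : Euc d} {k : Fin d → ℤ} (hx : x ∈ cell ε k) :
    ‖ψ x - ((ε : ℂ) ^ d)⁻¹ * ∫ y in cell ε k, ψ y‖ₑ ^ 2 ≤
      (ENNReal.ofReal ε ^ d)⁻¹ * ∫⁻ h in cube d ε, ‖ψ (x + h) - ψ x‖ₑ ^ 2 := by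
  set V : ℝ≥0∞ := ENNReal.ofReal ε ^ d with hV
  have hV0 : V ≠ 0 := pow_ne_zero _ (by simpa using hε)
  have hVt : V ≠ ⊤ := ENNReal.pow_ne_top ENNReal.ofReal_ne_top
  have hεd : (ε : ℂ) ^ d ≠ 0 := pow_ne_zero _ (by exact_mod_cast hε.ne')
  have hint : Integrable ψ := hψ.integrable_of_hasCompactSupport hc
  have hfin : volume (cell ε k) < ⊤ := by rw [volume_cell]; exact hVt.lt_top
  have hreal : volume.real (cell ε k) = ε ^ d := by
    rw [measureReal_def, volume_cell, ENNReal.toReal_pow, ENNReal.toReal_ofReal hε.le]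
  have heq : ψ x - ((ε : ℂ) ^ d)⁻¹ * ∫ y in cell ε k, ψ y =
      -(((ε : ℂ) ^ d)⁻¹ * ∫ y in cell ε k, (ψ y - ψ x)) := by
    rw [integral_sub hint.integrableOn (integrableOn_const hfin.ne), setIntegral_const, hreal]
    simp only [Complex.real_smul]
    push_cast
    field_simp
    ring
  have hnorm : ‖((ε : ℂ) ^ d)⁻¹‖ₑ = V⁻¹ := by
    rw [enorm_inv hεd, enorm_pow, hV, ← ofReal_norm, Complex.norm_real,
      Real.norm_of_nonneg hε.le]
  have hmeas : Measurable fun y => ‖ψ y - ψ x‖ₑ := by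
    have : Continuous fun y => ψ y - ψ x := by fun_prop
    exact this.enorm.measurable
  calc ‖ψ x - ((ε : ℂ) ^ d)⁻¹ * ∫ y in cell ε k, ψ y‖ₑ ^ 2
      ≤ V⁻¹ ^ 2 * (∫⁻ y in cell ε k, ‖ψ y - ψ x‖ₑ) ^ 2 := by
        rw [heq, enorm_neg, enorm_mul, hnorm, mul_pow]
        gcongr
        exact enorm_integral_le_lintegral_enorm _
    _ ≤ V⁻¹ ^ 2 * (V * ∫⁻ y in cell ε k, ‖ψ y - ψ x‖ₑ ^ 2) := by
        gcongr
        have := sq_lintegral_le (volume.restrict (cell ε k)) hmeas.aemeasurable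
        rwa [Measure.restrict_apply_univ, volume_cell] at this
    _ = V⁻¹ * ∫⁻ y in cell ε k, ‖ψ y - ψ x‖ₑ ^ 2 := by
        rw [sq, mul_assoc, ← mul_assoc V⁻¹ V, ENNReal.inv_mul_cancel hV0 hVt, one_mul]
    _ ≤ V⁻¹ * ∫⁻ h in cube d ε, ‖ψ (x + h) - ψ x‖ₑ ^ 2 := by
        refine mul_le_mul_right ?_ _
        -- Substitute `y = x + h`: two points of one cell differ by an element of the cube, so the
        -- cell lies in `x + cube d ε`.
        rw [← lintegral_indicator (measurableSet_cell ε k),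
          ← lintegral_indicator (measurableSet_cube ε),
          ← lintegral_add_left_eq_self _ x]
        refine lintegral_mono fun h => ?_
        by_cases hxh : x + h ∈ cell ε k
        · have hh : h ∈ cube d ε := fun i => by
            have h1 := hxh i
            have h2 := hx i
            simp only [PiLp.add_apply, mem_Ico] at h1 h2
            constructor <;> linarith [h1.1, h1.2, h2.1, h2.2]
          simp [indicator_of_mem hxh, indicator_of_mem hh]
        · simp [indicator_of_notMem hxh]

/-- Integrated form: the squared `L²` distance between `ψ` and its cell means. -/
theorem lintegral_enorm_sub_average_cell_sq_le {ε : ℝ} (hε : 0 < ε) {ψ : Euc d → ℂ}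
    (hψ : ContDiff ℝ 1 ψ) (hc : HasCompactSupport ψ) :
    ∫⁻ x, ‖ψ x - ((ε : ℂ) ^ d)⁻¹ * ∫ y in cell ε (cellIndex ε x), ψ y‖ₑ ^ 2 ≤
      ENNReal.ofReal (2 ^ d * (d * ε ^ 2)) * energy ψ := by
  set V : ℝ≥0∞ := ENNReal.ofReal ε ^ d with hV
  have hV0 : V ≠ 0 := pow_ne_zero _ (by simpa using hε)
  have hVt : V ≠ ⊤ := ENNReal.pow_ne_top ENNReal.ofReal_ne_top
  have hcont : Continuous fun p : Euc d × Euc d => ψ (p.1 + p.2) - ψ p.1 := by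
    have := hψ.continuous
    fun_prop
  calc ∫⁻ x, ‖ψ x - ((ε : ℂ) ^ d)⁻¹ * ∫ y in cell ε (cellIndex ε x), ψ y‖ₑ ^ 2
      ≤ ∫⁻ x, V⁻¹ * ∫⁻ h in cube d ε, ‖ψ (x + h) - ψ x‖ₑ ^ 2 :=
        lintegral_mono fun x =>
          enorm_sub_average_cell_sq_le hε hψ.continuous hc ((mem_cell_iff hε).2 rfl)
    _ = V⁻¹ * ∫⁻ h in cube d ε, ∫⁻ x, ‖ψ (x + h) - ψ x‖ₑ ^ 2 := by
        rw [lintegral_const_mul, lintegral_lintegral_swap]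
        · exact (hcont.enorm.measurable.pow_const 2).aemeasurable
        · exact (hcont.enorm.measurable.pow_const 2).lintegral_prod_right'
    _ ≤ V⁻¹ * ∫⁻ _h in cube d ε, ENNReal.ofReal (d * ε ^ 2) * energy ψ := by
        refine mul_le_mul_right ?_ _
        refine setLIntegral_mono' (measurableSet_cube ε) fun h hh => ?_
        refine (lintegral_enorm_translate_sub_sq_le hψ h).trans ?_
        gcongr
        rw [← ofReal_norm, ← ENNReal.ofReal_pow (norm_nonneg _)]
        exact ENNReal.ofReal_le_ofReal (norm_sq_le_of_mem_cube hh)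
    _ = ENNReal.ofReal (2 ^ d * (d * ε ^ 2)) * energy ψ := by
        -- The factor `2 ^ d` is the ratio of the volume of the cube, of side `2 * ε`, to that of a
        -- cell, of side `ε`.
        rw [setLIntegral_const, volume_cube, ENNReal.ofReal_mul (by positivity : (0 : ℝ) ≤ 2 ^ d),
          ENNReal.ofReal_mul zero_le_two, mul_pow, ← hV, ENNReal.ofReal_pow zero_le_two]
        calc V⁻¹ * (ENNReal.ofReal (d * ε ^ 2) * energy ψ * (ENNReal.ofReal 2 ^ d * V))
            = (V⁻¹ * V) * (ENNReal.ofReal 2 ^ d * ENNReal.ofReal (d * ε ^ 2) * energy ψ) := by ring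
          _ = _ := by rw [ENNReal.inv_mul_cancel hV0 hVt, one_mul]

/-! ### Test functions inside `L²(Ω)` -/

theorem testFunction_eq_zero_of_notMem {Ω : Opens (Euc d)} (ψ : 𝓓(Ω, ℂ)) {x : Euc d}
    (hx : x ∉ (Ω : Set (Euc d))) : ψ x = 0 := by
  by_contra hne
  exact hx (ψ.tsupport_subset (subset_tsupport _ hne))

theorem memLp_testFunction {Ω : Opens (Euc d)} (ψ : 𝓓(Ω, ℂ)) :
    MemLp ψ 2 ((volume : Measure (Euc d)).restrict (Ω : Set (Euc d))) :=
  (ψ.continuous.memLp_of_hasCompactSupport ψ.hasCompactSupport).restrict _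

/-- Test functions as elements of `L²(Ω)`. -/
def toL2 (Ω : Opens (Euc d)) : 𝓓(Ω, ℂ) →ₗ[ℂ] L2 Ω where
  toFun ψ := (memLp_testFunction ψ).toLp ψ
  map_add' _ _ := rfl
  map_smul' _ _ := rfl

theorem coeFn_toL2 {Ω : Opens (Euc d)} (ψ : 𝓓(Ω, ℂ)) :
    toL2 Ω ψ =ᵐ[(volume : Measure (Euc d)).restrict (Ω : Set (Euc d))] ψ :=
  MemLp.coeFn_toLp (memLp_testFunction ψ)

/-- The partial derivative of a test function, as a test function. -/
def testPartial (Ω : Opens (Euc d)) (i : Fin d) : 𝓓(Ω, ℂ) →ₗ[ℂ] 𝓓(Ω, ℂ) :=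
  (TestFunction.lineDerivCLM ℂ (EuclideanSpace.single i (1 : ℝ)) : 𝓓(Ω, ℂ) →L[ℂ] 𝓓(Ω, ℂ))

theorem coe_testPartial {Ω : Opens (Euc d)} (i : Fin d) (ψ : 𝓓(Ω, ℂ)) :
    ⇑(testPartial Ω i ψ) = partialD i ψ := by
  funext x
  have h := TestFunction.lineDerivCLM_apply_of_le (𝕜 := ℂ) (f := ψ) (k := (⊤ : ℕ∞))
    (v := EuclideanSpace.single i (1 : ℝ)) (x := x) le_rfl
  have hd : DifferentiableAt ℝ ψ x :=
    (ψ.contDiff.differentiable (by simp)).differentiableAt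
  rw [hd.lineDeriv_eq_fderiv] at h
  exact h

theorem enorm_toLp_sq {Ω : Opens (Euc d)} (f : L2 Ω) :
    ‖f‖ₑ ^ 2 = ∫⁻ x in (Ω : Set (Euc d)), ‖f x‖ₑ ^ 2 := by
  have h := eLpNorm_nnreal_pow_eq_lintegral (f := f) (p := 2)
    (μ := (volume : Measure (Euc d)).restrict (Ω : Set (Euc d))) two_ne_zero
  rw [Lp.enorm_def]
  simpa using h

theorem enorm_toL2_sq {Ω : Opens (Euc d)} (ψ : 𝓓(Ω, ℂ)) :
    ‖toL2 Ω ψ‖ₑ ^ 2 = ∫⁻ x, ‖ψ x‖ₑ ^ 2 := by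
  rw [enorm_toLp_sq, ← setLIntegral_eq_of_support_subset (s := (Ω : Set (Euc d))) (f := fun x => ‖ψ x‖ₑ ^ 2)]
  · refine lintegral_congr_ae ?_
    filter_upwards [coeFn_toL2 ψ] with x hx
    rw [hx]
  · intro x hx
    by_contra hne
    simp [testFunction_eq_zero_of_notMem ψ hne] at hx

/-- The Hilbert–Schmidt norm dominates the operator norm, by Cauchy–Schwarz in coordinates. This
links `energy`, defined by the operator norm of the derivative, to the partial derivatives. -/
theorem norm_sq_le_sum_norm_sq_apply_single (L : Euc d →L[ℝ] ℂ) :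
    ‖L‖ ^ 2 ≤ ∑ i, ‖L (EuclideanSpace.single i (1 : ℝ))‖ ^ 2 := by
  have h : ‖L‖ ≤ √(∑ i, ‖L (EuclideanSpace.single i (1 : ℝ))‖ ^ 2) := by
    refine L.opNorm_le_bound (Real.sqrt_nonneg _) fun x => ?_
    have hx : x = ∑ i, x i • EuclideanSpace.single i (1 : ℝ) := by
      ext j
      simp [Finset.sum_apply, Pi.single_apply]
    calc ‖L x‖ = ‖∑ i, x i • L (EuclideanSpace.single i (1 : ℝ))‖ := by
          conv_lhs => rw [hx]
          simp only [map_sum, map_smul]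
      _ ≤ ∑ i, ‖L (EuclideanSpace.single i (1 : ℝ))‖ * ‖x i‖ := by
          refine (norm_sum_le _ _).trans (Finset.sum_le_sum fun i _ => ?_)
          rw [norm_smul, mul_comm]
      _ ≤ _ := by
          rw [EuclideanSpace.norm_eq]
          exact Real.sum_mul_le_sqrt_mul_sqrt _ _ _
  calc ‖L‖ ^ 2 ≤ _ := pow_le_pow_left₀ (norm_nonneg _) h 2
    _ = _ := Real.sq_sqrt (Finset.sum_nonneg fun i _ => sq_nonneg _)

theorem energy_le_sum {Ω : Opens (Euc d)} (ψ : 𝓓(Ω, ℂ)) :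
    energy ψ ≤ ENNReal.ofReal (∑ i, ‖toL2 Ω (testPartial Ω i ψ)‖ ^ 2) := by
  rw [ENNReal.ofReal_sum_of_nonneg fun i _ => sq_nonneg _]
  simp_rw [ENNReal.ofReal_pow (norm_nonneg _), ofReal_norm, enorm_toL2_sq]
  rw [← lintegral_finsetSum _ fun i _ => (testPartial Ω i ψ).continuous.enorm.measurable.pow_const 2]
  refine lintegral_mono fun x => ?_
  have := ENNReal.ofReal_le_ofReal (norm_sq_le_sum_norm_sq_apply_single (fderiv ℝ ψ x))
  rw [ENNReal.ofReal_sum_of_nonneg fun i _ => sq_nonneg _] at this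
  simp_rw [ENNReal.ofReal_pow (norm_nonneg _), ofReal_norm] at this
  simp_rw [coe_testPartial]
  exact this

/-- The Poincaré inequality for test functions, in terms of `L²`-norms. -/
theorem exists_norm_toL2_sq_le (hd : 1 ≤ d) (Ω : Opens (Euc d))
    (hbdd : Bornology.IsBounded (Ω : Set (Euc d))) :
    ∃ C : ℝ, ∀ ψ : 𝓓(Ω, ℂ),
      ‖toL2 Ω ψ‖ ^ 2 ≤ C * ∑ i, ‖toL2 Ω (testPartial Ω i ψ)‖ ^ 2 := by
  obtain ⟨C, hC⟩ := exists_poincare hd Ω hbdd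
  refine ⟨|C|, fun ψ => ?_⟩
  have h := (hC ψ).trans (mul_le_mul' (ENNReal.ofReal_le_ofReal (le_abs_self C)) (energy_le_sum ψ))
  rw [← enorm_toL2_sq, ← ofReal_norm, ← ENNReal.ofReal_pow (norm_nonneg _),
    ← ENNReal.ofReal_mul (abs_nonneg _)] at h
  exact (ENNReal.ofReal_le_ofReal_iff (by positivity)).1 h

/-! ### Finite-rank averaging operators and Rellich's estimate -/

theorem volume_restrict_cell_ne_top (Ω : Opens (Euc d)) (ε : ℝ) (k : Fin d → ℤ) :
    ((volume : Measure (Euc d)).restrict (Ω : Set (Euc d))) (cell ε k) ≠ ⊤ := by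
  refine ((Measure.restrict_apply_le _ _).trans_lt ?_).ne
  rw [volume_cell]
  exact (ENNReal.pow_ne_top ENNReal.ofReal_ne_top).lt_top

/-- The normalised characteristic function of a cell, in `L²(Ω)`. -/
def cellL2 (Ω : Opens (Euc d)) (ε : ℝ) (k : Fin d → ℤ) : L2 Ω :=
  indicatorConstLp 2 (measurableSet_cell ε k) (volume_restrict_cell_ne_top Ω ε k) (1 : ℂ)

/-- Averaging over the cells with index in `K`, an operator of finite rank. -/
def averaging (Ω : Opens (Euc d)) (ε : ℝ) (K : Finset (Fin d → ℤ)) : L2 Ω →L[ℂ] L2 Ω :=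
  ∑ k ∈ K, ((ε : ℂ) ^ d)⁻¹ •
    (ContinuousLinearMap.toSpanSingleton ℂ (cellL2 Ω ε k) ∘L innerSL ℂ (cellL2 Ω ε k))

theorem isCompactOperator_averaging (Ω : Opens (Euc d)) (ε : ℝ) (K : Finset (Fin d → ℤ)) :
    IsCompactOperator (averaging Ω ε K) := by
  have : averaging Ω ε K ∈ (compactOperator (RingHom.id ℂ) (L2 Ω) (L2 Ω)) := by
    unfold averaging
    refine Submodule.sum_mem _ fun k _ => Submodule.smul_mem _ _ ?_
    have h : IsCompactOperator (ContinuousLinearMap.toSpanSingleton ℂ (cellL2 Ω ε k)) :=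
      isCompactOperator_of_locallyCompactSpace_rng _
    exact h.comp_clm _
  exact this

/-- The half-open cells are disjoint, so at almost every point of `Ω` only the summand of the cell
containing it survives. The inner product with a cell's characteristic function is the integral over
the whole cell, because `ψ` vanishes off `Ω`. -/
theorem averaging_toL2_ae {Ω : Opens (Euc d)} {ε : ℝ} (hε : 0 < ε) {K : Finset (Fin d → ℤ)}
    (hK : ∀ x ∈ (Ω : Set (Euc d)), cellIndex ε x ∈ K) (ψ : 𝓓(Ω, ℂ)) :
    ∀ᵐ x ∂(volume : Measure (Euc d)).restrict (Ω : Set (Euc d)),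
      averaging Ω ε K (toL2 Ω ψ) x =
        ((ε : ℂ) ^ d)⁻¹ * ∫ y in cell ε (cellIndex ε x), ψ y := by
  have hint : ∀ k, inner ℂ (cellL2 Ω ε k) (toL2 Ω ψ) = ∫ y in cell ε k, ψ y := by
    intro k
    rw [cellL2, L2.inner_indicatorConstLp_one, Measure.restrict_restrict (measurableSet_cell ε k)]
    have h1 : ∫ y in cell ε k ∩ (Ω : Set (Euc d)), (toL2 Ω ψ) y =
        ∫ y in cell ε k ∩ (Ω : Set (Euc d)), ψ y := by
      refine integral_congr_ae ?_
      exact ae_restrict_of_ae_restrict_of_subset inter_subset_right (coeFn_toL2 ψ)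
    rw [h1]
    exact (setIntegral_eq_of_subset_of_forall_sdiff_eq_zero (measurableSet_cell ε k)
      inter_subset_left fun x hx =>
        testFunction_eq_zero_of_notMem ψ fun hxΩ => hx.2 ⟨hx.1, hxΩ⟩).symm
  have hexp : averaging Ω ε K (toL2 Ω ψ) =
      ∑ k ∈ K, (((ε : ℂ) ^ d)⁻¹ * ∫ y in cell ε k, ψ y) • cellL2 Ω ε k := by
    simp only [averaging, sum_apply, smul_apply,
      ContinuousLinearMap.comp_apply, ContinuousLinearMap.toSpanSingleton_apply, innerSL_apply_apply,
      hint, smul_smul]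
  rw [hexp]
  have h1 : ∀ᵐ x ∂(volume : Measure (Euc d)).restrict (Ω : Set (Euc d)), ∀ k ∈ K,
      ((((ε : ℂ) ^ d)⁻¹ * ∫ y in cell ε k, ψ y) • cellL2 Ω ε k : L2 Ω) x =
        (((ε : ℂ) ^ d)⁻¹ * ∫ y in cell ε k, ψ y) * (cell ε k).indicator (fun _ => (1 : ℂ)) x := by
    rw [Filter.eventually_all_finset]
    intro k _
    filter_upwards [Lp.coeFn_smul (((ε : ℂ) ^ d)⁻¹ * ∫ y in cell ε k, ψ y) (cellL2 Ω ε k),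
      indicatorConstLp_coeFn (p := 2) (hs := measurableSet_cell ε k)
        (hμs := volume_restrict_cell_ne_top Ω ε k) (c := (1 : ℂ))] with x h2 h3
    rw [h2, Pi.smul_apply, cellL2, h3, smul_eq_mul]
  filter_upwards [h1, Lp.coeFn_finsetSum K fun k =>
    ((((ε : ℂ) ^ d)⁻¹ * ∫ y in cell ε k, ψ y) • cellL2 Ω ε k : L2 Ω),
    ae_restrict_mem Ω.isOpen.measurableSet] with x hx hs hxΩ
  rw [hs, Finset.sum_apply, Finset.sum_congr rfl hx, Finset.sum_eq_single (cellIndex ε x)]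
  · rw [indicator_of_mem ((mem_cell_iff hε).2 rfl), mul_one]
  · intro k _ hk
    rw [indicator_of_notMem fun h => hk ((mem_cell_iff hε).1 h), mul_zero]
  · exact fun h => absurd (hK x hxΩ) h

theorem exists_finset_cellIndex_mem {Ω : Set (Euc d)} (hbdd : Bornology.IsBounded Ω) {ε : ℝ}
    (hε : 0 < ε) : ∃ K : Finset (Fin d → ℤ), ∀ x ∈ Ω, cellIndex ε x ∈ K := by
  obtain ⟨R, hR⟩ := hbdd.exists_norm_le
  refine ⟨Fintype.piFinset fun _ => Finset.Icc ⌊-R / ε⌋ ⌊R / ε⌋, fun x hx => ?_⟩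
  rw [Fintype.mem_piFinset]
  intro i
  have h := abs_le.1 ((PiLp.norm_apply_le x i).trans (hR x hx))
  rw [Finset.mem_Icc]
  exact ⟨Int.floor_le_floor (by gcongr; exact h.1), Int.floor_le_floor (by gcongr; exact h.2)⟩

/-- Rellich's theorem in quantitative form: on test functions the identity of `L²(Ω)` is
approximated by compact operators, up to small multiples of the gradient norm. -/
theorem exists_compact_norm_sub_le (Ω : Opens (Euc d))
    (hbdd : Bornology.IsBounded (Ω : Set (Euc d))) {δ : ℝ} (hδ : 0 < δ) :
    ∃ A : L2 Ω →L[ℂ] L2 Ω, IsCompactOperator A ∧ ∀ ψ : 𝓓(Ω, ℂ),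
      ‖toL2 Ω ψ - A (toL2 Ω ψ)‖ ^ 2 ≤ δ ^ 2 * ∑ i, ‖toL2 Ω (testPartial Ω i ψ)‖ ^ 2 := by
  obtain ⟨ε, hε, hεδ⟩ : ∃ ε : ℝ, 0 < ε ∧ 2 ^ d * (d * ε ^ 2) ≤ δ ^ 2 := by
    -- `d + 1` in place of `d` keeps the divisor positive also when `d = 0`.
    refine ⟨δ / √(2 ^ d * (d + 1)), by positivity, ?_⟩
    rw [div_pow, Real.sq_sqrt (by positivity)]
    have : (0 : ℝ) < 2 ^ d * (d + 1) := by positivity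
    rw [← mul_assoc, mul_div_assoc', div_le_iff₀ this, mul_comm (δ ^ 2)]
    gcongr
    linarith
  obtain ⟨K, hK⟩ := exists_finset_cellIndex_mem hbdd hε
  refine ⟨averaging Ω ε K, isCompactOperator_averaging Ω ε K, fun ψ => ?_⟩
  have h : ‖toL2 Ω ψ - averaging Ω ε K (toL2 Ω ψ)‖ₑ ^ 2 ≤
      ENNReal.ofReal (δ ^ 2) * ENNReal.ofReal (∑ i, ‖toL2 Ω (testPartial Ω i ψ)‖ ^ 2) := by
    calc ‖toL2 Ω ψ - averaging Ω ε K (toL2 Ω ψ)‖ₑ ^ 2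
        = ∫⁻ x in (Ω : Set (Euc d)),
            ‖ψ x - ((ε : ℂ) ^ d)⁻¹ * ∫ y in cell ε (cellIndex ε x), ψ y‖ₑ ^ 2 := by
          rw [enorm_toLp_sq]
          refine lintegral_congr_ae ?_
          filter_upwards [Lp.coeFn_sub (toL2 Ω ψ) (averaging Ω ε K (toL2 Ω ψ)), coeFn_toL2 ψ,
            averaging_toL2_ae hε hK ψ] with x h1 h2 h3
          rw [h1, Pi.sub_apply, h2, h3]
      _ ≤ ∫⁻ x, ‖ψ x - ((ε : ℂ) ^ d)⁻¹ * ∫ y in cell ε (cellIndex ε x), ψ y‖ₑ ^ 2 :=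
          setLIntegral_le_lintegral _ _
      _ ≤ ENNReal.ofReal (2 ^ d * (d * ε ^ 2)) * energy ψ :=
          lintegral_enorm_sub_average_cell_sq_le hε
            (ψ.contDiff.of_le (by exact_mod_cast le_top)) ψ.hasCompactSupport
      _ ≤ _ := mul_le_mul' (ENNReal.ofReal_le_ofReal hεδ) (energy_le_sum ψ)
  rw [← ofReal_norm, ← ENNReal.ofReal_pow (norm_nonneg _),
    ← ENNReal.ofReal_mul (by positivity)] at h
  exact (ENNReal.ofReal_le_ofReal_iff (by positivity)).1 h

/-! ### Weak derivatives in terms of the inner product -/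

/-- The complex conjugate of a test function. -/
def conjTest {Ω : Opens (Euc d)} (ψ : 𝓓(Ω, ℂ)) : 𝓓(Ω, ℂ) :=
  TestFunction.postcompCLM (Complex.conjCLE : ℂ →L[ℝ] ℂ) ψ

theorem conjTest_apply {Ω : Opens (Euc d)} (ψ : 𝓓(Ω, ℂ)) (x : Euc d) :
    conjTest ψ x = (starRingEnd ℂ) (ψ x) := rfl

theorem conjTest_conjTest {Ω : Opens (Euc d)} (ψ : 𝓓(Ω, ℂ)) : conjTest (conjTest ψ) = ψ := by
  ext x
  simp [conjTest_apply]

theorem testPartial_conjTest {Ω : Opens (Euc d)} (i : Fin d) (ψ : 𝓓(Ω, ℂ)) :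
    testPartial Ω i (conjTest ψ) = conjTest (testPartial Ω i ψ) := by
  ext x
  rw [conjTest_apply, coe_testPartial, coe_testPartial]
  have hd : DifferentiableAt ℝ ψ x :=
    (ψ.contDiff.differentiable (by simp)).differentiableAt
  have h := (Complex.conjCLE : ℂ →L[ℝ] ℂ).hasFDerivAt.comp x hd.hasFDerivAt
  have h' : HasFDerivAt (conjTest ψ) ((Complex.conjCLE : ℂ →L[ℝ] ℂ).comp (fderiv ℝ ψ x)) x := h
  rw [partialD, h'.fderiv]
  rfl

theorem inner_toL2 {Ω : Opens (Euc d)} (ψ : 𝓓(Ω, ℂ)) (f : L2 Ω) :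
    inner ℂ (toL2 Ω ψ) f = ∫ x in (Ω : Set (Euc d)), f x * conjTest ψ x := by
  rw [L2.inner_def]
  refine integral_congr_ae ?_
  filter_upwards [coeFn_toL2 ψ] with x hx
  rw [hx, RCLike.inner_apply, conjTest_apply]

theorem inner_toL2_conjTest {Ω : Opens (Euc d)} (ψ : 𝓓(Ω, ℂ)) (f : L2 Ω) :
    inner ℂ (toL2 Ω (conjTest ψ)) f = ∫ x in (Ω : Set (Euc d)), f x * ψ x := by
  rw [inner_toL2, conjTest_conjTest]

/-- Weak derivatives are defined by a bilinear pairing; replacing the test function by its conjugate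
turns it into the inner product. In this form the condition is visibly closed in `f` and `g`. -/
theorem isWeakPartial_iff_inner {Ω : Opens (Euc d)} {i : Fin d} {f g : L2 Ω} :
    IsWeakPartial Ω i f g ↔ ∀ ψ : 𝓓(Ω, ℂ),
      inner ℂ (toL2 Ω (testPartial Ω i ψ)) f = -inner ℂ (toL2 Ω ψ) g := by
  constructor
  · intro h ψ
    rw [inner_toL2, inner_toL2, ← testPartial_conjTest, coe_testPartial]
    exact h _
  · intro h ψ
    have := h (conjTest ψ)
    rwa [testPartial_conjTest, inner_toL2_conjTest, inner_toL2_conjTest, coe_testPartial] at this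

/-- Integration by parts over the whole space, with no boundary term because the supports are
compact. -/
theorem isWeakPartial_toL2 {Ω : Opens (Euc d)} (i : Fin d) (φ : 𝓓(Ω, ℂ)) :
    IsWeakPartial Ω i (toL2 Ω φ) (toL2 Ω (testPartial Ω i φ)) := by
  intro ψ
  have hint : ∀ φ ψ : 𝓓(Ω, ℂ), Integrable (fun x => φ x * ψ x) := fun φ ψ =>
    (φ.continuous.mul ψ.continuous).integrable_of_hasCompactSupport ψ.hasCompactSupport.mul_left
  have hext : ∀ φ ψ : 𝓓(Ω, ℂ),
      ∫ x in (Ω : Set (Euc d)), (toL2 Ω φ) x * ψ x = ∫ x, φ x * ψ x := by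
    intro φ ψ
    rw [← setIntegral_eq_integral_of_forall_compl_eq_zero (s := (Ω : Set (Euc d)))
      (f := fun x => φ x * ψ x)
      fun x hx => by rw [testFunction_eq_zero_of_notMem ψ hx, mul_zero]]
    refine integral_congr_ae ?_
    filter_upwards [coeFn_toL2 φ] with x hx
    rw [hx]
  have hd : ∀ (φ : 𝓓(Ω, ℂ)) (x : Euc d), DifferentiableAt ℝ φ x := fun φ x =>
    (φ.contDiff.differentiable (by simp)).differentiableAt
  have h1 := integral_mul_fderiv_eq_neg_fderiv_mul_of_integrable
    (μ := (volume : Measure (Euc d))) (f := φ) (g := ψ) (v := EuclideanSpace.single i (1 : ℝ))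
    (by have := hint (testPartial Ω i φ) ψ; rw [coe_testPartial] at this; exact this)
    (by have := hint φ (testPartial Ω i ψ); rw [coe_testPartial] at this; exact this) (hint φ ψ)
    (fun x _ => hd φ x) (fun x _ => hd ψ x)
  have h2 := hext φ (testPartial Ω i ψ)
  have h3 := hext (testPartial Ω i φ) ψ
  rw [coe_testPartial] at h2
  rw [h2, h3, coe_testPartial]
  exact h1

theorem isWeakPartial_weakPartial {Ω : Opens (Euc d)} {i : Fin d} {f : L2 Ω}
    (h : ∃ g, IsWeakPartial Ω i f g) : IsWeakPartial Ω i f (weakPartial Ω i f) := by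
  obtain ⟨g, hg⟩ := h
  rwa [hg.eq]

/-! ### `H₀¹(Ω)` as a Hilbert space of jets, Green's formula, compact embedding -/

/-- Square-integrable functions together with candidates for their first derivatives. -/
abbrev JetSpace (Ω : Opens (Euc d)) : Type := PiLp 2 (fun _ : Option (Fin d) => L2 Ω)

/-- A function together with its first derivatives, for test functions. -/
def testJet (Ω : Opens (Euc d)) : 𝓓(Ω, ℂ) →ₗ[ℂ] JetSpace Ω where
  toFun ψ := WithLp.toLp 2 fun o => o.elim (toL2 Ω ψ) fun i => toL2 Ω (testPartial Ω i ψ)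
  map_add' φ ψ := by
    ext1 o
    cases o <;> simp
  map_smul' c ψ := by
    ext1 o
    cases o <;> simp

theorem testJet_none {Ω : Opens (Euc d)} (ψ : 𝓓(Ω, ℂ)) : testJet Ω ψ none = toL2 Ω ψ := rfl

theorem testJet_some {Ω : Opens (Euc d)} (ψ : 𝓓(Ω, ℂ)) (i : Fin d) :
    testJet Ω ψ (some i) = toL2 Ω (testPartial Ω i ψ) := rfl

/-- A function together with its weak first derivatives. -/
def weakJet (Ω : Opens (Euc d)) (f : L2 Ω) : JetSpace Ω :=
  WithLp.toLp 2 fun o => o.elim f fun i => weakPartial Ω i f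

/-- The space `H₀¹(Ω)`, realised as a closed subspace of the jet space. -/
def sobolev (Ω : Opens (Euc d)) : Submodule ℂ (JetSpace Ω) :=
  (LinearMap.range (testJet Ω)).topologicalClosure

instance (Ω : Opens (Euc d)) : CompleteSpace (sobolev Ω) :=
  (Submodule.isClosed_topologicalClosure _).completeSpace_coe

theorem testJet_mem_sobolev {Ω : Opens (Euc d)} (ψ : 𝓓(Ω, ℂ)) : testJet Ω ψ ∈ sobolev Ω :=
  Submodule.le_topologicalClosure _ ⟨ψ, rfl⟩

/-- A closed condition satisfied by the jets of test functions holds on `H₀¹(Ω)`. -/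
theorem sobolev_induction {Ω : Opens (Euc d)} {P : JetSpace Ω → Prop}
    (hP : IsClosed {v | P v}) (h : ∀ ψ, P (testJet Ω ψ)) {v : JetSpace Ω} (hv : v ∈ sobolev Ω) :
    P v := by
  refine closure_minimal (s := (LinearMap.range (testJet Ω) : Set (JetSpace Ω))) ?_ hP hv
  rintro _ ⟨ψ, rfl⟩
  exact h ψ

/-- Against a fixed test function the defining identity is continuous in the jet, so it survives the
closure. Hence a jet in `sobolev Ω` is determined by its function component. -/
theorem isWeakPartial_of_mem_sobolev {Ω : Opens (Euc d)} {v : JetSpace Ω} (hv : v ∈ sobolev Ω)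
    (i : Fin d) : IsWeakPartial Ω i (v none) (v (some i)) := by
  rw [isWeakPartial_iff_inner]
  intro ψ
  refine sobolev_induction (P := fun v : JetSpace Ω =>
    inner ℂ (toL2 Ω (testPartial Ω i ψ)) (v none) = -inner ℂ (toL2 Ω ψ) (v (some i))) ?_ ?_ hv
  · exact isClosed_eq (by fun_prop) (by fun_prop)
  · intro φ
    exact isWeakPartial_iff_inner.1 (isWeakPartial_toL2 i φ) ψ

theorem weakPartial_of_mem_sobolev {Ω : Opens (Euc d)} {v : JetSpace Ω} (hv : v ∈ sobolev Ω)
    (i : Fin d) : weakPartial Ω i (v none) = v (some i) :=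
  (isWeakPartial_of_mem_sobolev hv i).eq

theorem tendsto_toL2_iff {Ω : Opens (Euc d)} (ψ : ℕ → 𝓓(Ω, ℂ)) (f : L2 Ω) :
    Tendsto (fun k => toL2 Ω (ψ k)) atTop (𝓝 f) ↔
      Tendsto (fun k => eLpNorm (fun x => ψ k x - f x) 2
        ((volume : Measure (Euc d)).restrict (Ω : Set (Euc d)))) atTop (𝓝 0) := by
  rw [Lp.tendsto_Lp_iff_tendsto_eLpNorm']
  refine iff_of_eq ?_
  congr 1
  funext k
  refine eLpNorm_congr_ae ?_
  filter_upwards [coeFn_toL2 (ψ k)] with x hx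
  rw [Pi.sub_apply, hx]

theorem memH10_of_mem_sobolev {Ω : Opens (Euc d)} {v : JetSpace Ω} (hv : v ∈ sobolev Ω) :
    MemH10 Ω (v none) := by
  refine ⟨fun i => ⟨_, isWeakPartial_of_mem_sobolev hv i⟩, ?_⟩
  obtain ⟨s, hs, hlim⟩ := mem_closure_iff_seq_limit.1 hv
  choose ψ hψ using hs
  have hcomp : ∀ o, Tendsto (fun k => testJet Ω (ψ k) o) atTop (𝓝 (v o)) := by
    intro o
    simp_rw [hψ]
    exact ((PiLp.continuous_apply 2 _ o).tendsto v).comp hlim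
  refine ⟨ψ, (tendsto_toL2_iff ψ _).1 (hcomp none), fun i => ?_⟩
  have h := (tendsto_toL2_iff (fun k => testPartial Ω i (ψ k)) _).1 (hcomp (some i))
  rw [weakPartial_of_mem_sobolev hv i]
  simpa only [coe_testPartial] using h

theorem weakJet_mem_sobolev {Ω : Opens (Euc d)} {f : L2 Ω} (hf : MemH10 Ω f) :
    weakJet Ω f ∈ sobolev Ω := by
  obtain ⟨-, ψ, h0, h1⟩ := hf
  refine mem_closure_iff_seq_limit.2 ⟨fun k => testJet Ω (ψ k), fun k => ⟨ψ k, rfl⟩, ?_⟩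
  refine ((PiLp.continuous_toLp 2 (fun _ : Option (Fin d) => L2 Ω)).tendsto _).comp
    (tendsto_pi_nhds.2 fun o => ?_)
  cases o with
  | none => exact (tendsto_toL2_iff ψ f).2 h0
  | some i =>
    refine (tendsto_toL2_iff (fun k => testPartial Ω i (ψ k)) (weakPartial Ω i f)).2 ?_
    simpa only [coe_testPartial] using h1 i

theorem inner_jet {Ω : Opens (Euc d)} (v w : JetSpace Ω) :
    inner ℂ v w = inner ℂ (v none) (w none) + ∑ i, inner ℂ (v (some i)) (w (some i)) := by
  rw [PiLp.inner_apply, Fintype.sum_option]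

theorem norm_jet_sq {Ω : Opens (Euc d)} (v : JetSpace Ω) :
    ‖v‖ ^ 2 = ‖v none‖ ^ 2 + ∑ i, ‖v (some i)‖ ^ 2 := by
  rw [PiLp.norm_sq_eq_of_L2, Fintype.sum_option]

/-- Green's formula: `⟨f, v⟩_{H¹} = ⟨f - Δf, v⟩_{L²}` for `f ∈ H²(Ω)` and `v ∈ H₀¹(Ω)`. -/
theorem inner_weakJet {Ω : Opens (Euc d)} {f : L2 Ω} (hf : MemH2 Ω f) {v : JetSpace Ω}
    (hv : v ∈ sobolev Ω) :
    inner ℂ (weakJet Ω f) v = inner ℂ (f - laplacian Ω f) (v none) := by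
  refine sobolev_induction (P := fun v : JetSpace Ω =>
    inner ℂ (weakJet Ω f) v = inner ℂ (f - laplacian Ω f) (v none)) ?_ ?_ hv
  · exact isClosed_eq (by fun_prop) (by fun_prop)
  · intro ψ
    have h : ∀ i, inner ℂ (weakPartial Ω i f) (toL2 Ω (testPartial Ω i ψ)) =
        -inner ℂ (weakPartial Ω i (weakPartial Ω i f)) (toL2 Ω ψ) := by
      intro i
      have := isWeakPartial_iff_inner.1 (isWeakPartial_weakPartial (hf.2 i i)) ψ
      rw [← inner_conj_symm, this, map_neg, inner_conj_symm]
    rw [inner_jet, testJet_none]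
    simp only [testJet_some, weakJet, Option.elim]
    rw [Finset.sum_congr rfl fun i _ => h i, Finset.sum_neg_distrib, inner_sub_left, laplacian,
      sum_inner, sub_eq_add_neg]

/-- The embedding of `H₀¹(Ω)` into `L²(Ω)`. -/
def sobolevEmbedding (Ω : Opens (Euc d)) : sobolev Ω →L[ℂ] L2 Ω :=
  PiLp.proj 2 (fun _ : Option (Fin d) => L2 Ω) none ∘L (sobolev Ω).subtypeL

theorem sobolevEmbedding_apply {Ω : Opens (Euc d)} (v : sobolev Ω) :
    sobolevEmbedding Ω v = (v : JetSpace Ω) none := rfl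

/-- The compact operators are closed in the operator norm. -/
theorem isCompactOperator_of_forall_norm_sub_le {E F : Type*} [NormedAddCommGroup E]
    [NormedSpace ℂ E] [NormedAddCommGroup F] [NormedSpace ℂ F] [CompleteSpace F] (f : E →L[ℂ] F)
    (h : ∀ δ : ℝ, 0 < δ → ∃ A : E →L[ℂ] F, IsCompactOperator A ∧ ∀ v, ‖f v - A v‖ ≤ δ * ‖v‖) :
    IsCompactOperator f := by
  have hcl : IsClosed {f : E →L[ℂ] F | IsCompactOperator f} :=
    isClosed_setOfPred_isCompactOperator
  refine hcl.closure_subset (Metric.mem_closure_iff.2 fun δ hδ => ?_)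
  obtain ⟨A, hA, hbound⟩ := h (δ / 2) (half_pos hδ)
  refine ⟨A, hA, ?_⟩
  rw [dist_eq_norm]
  exact (ContinuousLinearMap.opNorm_le_bound _ (half_pos hδ).le hbound).trans_lt (half_lt_self hδ)

/-- Rellich's theorem. -/
theorem isCompactOperator_sobolevEmbedding (Ω : Opens (Euc d))
    (hbdd : Bornology.IsBounded (Ω : Set (Euc d))) : IsCompactOperator (sobolevEmbedding Ω) := by
  refine isCompactOperator_of_forall_norm_sub_le _ fun δ hδ => ?_
  obtain ⟨A, hA, hbound⟩ := exists_compact_norm_sub_le Ω hbdd hδ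
  refine ⟨A ∘L sobolevEmbedding Ω, hA.comp_clm _, fun v => ?_⟩
  -- The estimate is a closed condition on the jet, so it need only be checked on test functions,
  -- where the jet norm dominates the gradient norm.
  have key : ‖(v : JetSpace Ω) none - A ((v : JetSpace Ω) none)‖ ≤ δ * ‖(v : JetSpace Ω)‖ := by
    refine sobolev_induction (P := fun v : JetSpace Ω => ‖v none - A (v none)‖ ≤ δ * ‖v‖)
      ?_ ?_ v.2
    · exact isClosed_le (by fun_prop) (by fun_prop)
    · intro ψ
      refine (pow_le_pow_iff_left₀ (norm_nonneg _) (by positivity) two_ne_zero).1 ?_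
      rw [mul_pow, norm_jet_sq]
      refine (hbound ψ).trans ?_
      gcongr
      exact le_add_of_nonneg_left (sq_nonneg _)
  exact key

/-- The Poincaré inequality on `H₀¹(Ω)`. -/
theorem exists_poincare_sobolev (hd : 1 ≤ d) (Ω : Opens (Euc d))
    (hbdd : Bornology.IsBounded (Ω : Set (Euc d))) :
    ∃ C : ℝ, ∀ v ∈ sobolev Ω, ‖v none‖ ^ 2 ≤ C * ∑ i, ‖v (some i)‖ ^ 2 := by
  obtain ⟨C, hC⟩ := exists_norm_toL2_sq_le hd Ω hbdd
  refine ⟨C, fun v hv => ?_⟩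
  refine sobolev_induction (P := fun v : JetSpace Ω =>
    ‖v none‖ ^ 2 ≤ C * ∑ i, ‖v (some i)‖ ^ 2) ?_ hC hv
  exact isClosed_le (by fun_prop) (by fun_prop)

/-! ### The Dirichlet resolvent and its eigenvalues -/

/-- The resolvent `(1 - Δ)⁻¹` of the Dirichlet Laplacian. -/
def resolvent (Ω : Opens (Euc d)) : L2 Ω →L[ℂ] L2 Ω :=
  sobolevEmbedding Ω ∘L (sobolevEmbedding Ω).adjoint

theorem isSymmetric_resolvent (Ω : Opens (Euc d)) :
    (resolvent Ω : L2 Ω →ₗ[ℂ] L2 Ω).IsSymmetric := by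
  intro f g
  simp only [ContinuousLinearMap.coe_coe, resolvent, ContinuousLinearMap.comp_apply]
  rw [← ContinuousLinearMap.adjoint_inner_right, ContinuousLinearMap.adjoint_inner_left]

theorem isCompactOperator_resolvent (Ω : Opens (Euc d))
    (hbdd : Bornology.IsBounded (Ω : Set (Euc d))) : IsCompactOperator (resolvent Ω) :=
  (isCompactOperator_sobolevEmbedding Ω hbdd).comp_clm _

/-- By Green's formula the weak jet of `f` is the Riesz representative of `v ↦ ⟨f - Δf, v⟩` on
`H₀¹(Ω)`, that is, the adjoint of the embedding applied to `f - Δf`; its function component is `f`.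
-/
theorem resolvent_sub_laplacian {Ω : Opens (Euc d)} {f : L2 Ω} (h2 : MemH2 Ω f)
    (h1 : MemH10 Ω f) : resolvent Ω (f - laplacian Ω f) = f := by
  have h : (sobolevEmbedding Ω).adjoint (f - laplacian Ω f) =
      ⟨weakJet Ω f, weakJet_mem_sobolev h1⟩ := by
    refine ext_inner_right ℂ fun v => ?_
    rw [ContinuousLinearMap.adjoint_inner_left, sobolevEmbedding_apply, ← inner_weakJet h2 v.2]
    rfl
  rw [resolvent, ContinuousLinearMap.comp_apply, h]
  rfl

/-- If `w ∈ H₀¹(Ω)` represents `⟨e, ·⟩_{L²}` in `H¹` and `w = ν e`, then `ν⁻¹ - 1` is a Dirichlet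
eigenvalue. -/
theorem isDirichletEigenvalue_of_inner {Ω : Opens (Euc d)} {e : L2 Ω} (he : e ≠ 0) {ν : ℝ}
    (hν : ν ≠ 0) {w : JetSpace Ω} (hw : w ∈ sobolev Ω) (hw0 : w none = (ν : ℂ) • e)
    (hinner : ∀ v ∈ sobolev Ω, inner ℂ w v = inner ℂ e (v none)) :
    IsDirichletEigenvalue Ω (ν⁻¹ - 1) := by
  have hνC : (ν : ℂ) ≠ 0 := by exact_mod_cast hν
  have hφ : w none ≠ 0 := by rw [hw0]; exact smul_ne_zero hνC he
  refine ⟨w none, hφ, memH10_of_mem_sobolev hw, fun ψ => ?_⟩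
  -- The eigenvalue equation is bilinear and the inner product sesquilinear, so the test function is
  -- conjugated here and the resulting identity once more below.
  have h := hinner (testJet Ω (conjTest ψ)) (testJet_mem_sobolev _)
  have he' : e = (ν : ℂ)⁻¹ • w none := by
    rw [hw0, smul_smul, inv_mul_cancel₀ hνC, one_smul]
  rw [inner_jet, testJet_none] at h
  simp only [testJet_some] at h
  have h' := congrArg (starRingEnd ℂ) h
  rw [map_add, map_sum] at h'
  simp only [inner_conj_symm, testPartial_conjTest, inner_toL2_conjTest] at h'
  have h3 : ∫ x in (Ω : Set (Euc d)), e x * ψ x =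
      (ν : ℂ)⁻¹ * ∫ x in (Ω : Set (Euc d)), (w none) x * ψ x := by
    rw [← inner_toL2_conjTest, ← inner_toL2_conjTest, ← inner_smul_right, ← he']
  rw [h3] at h'
  simp only [weakPartial_of_mem_sobolev hw]
  simp only [coe_testPartial] at h'
  rw [Complex.ofReal_sub, Complex.ofReal_inv, Complex.ofReal_one]
  linear_combination h'

/-- The bounds on `ν` in the situation of `isDirichletEigenvalue_of_inner`. -/
theorem mem_Ioo_of_inner (hd : 1 ≤ d) {Ω : Opens (Euc d)}
    (hbdd : Bornology.IsBounded (Ω : Set (Euc d))) {e : L2 Ω} (he : e ≠ 0) {ν : ℝ}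
    (hν : ν ≠ 0) {w : JetSpace Ω} (hw : w ∈ sobolev Ω) (hw0 : w none = (ν : ℂ) • e)
    (hinner : ∀ v ∈ sobolev Ω, inner ℂ w v = inner ℂ e (v none)) :
    ν ∈ Ioo 0 1 := by
  -- Take `v = w` in `hinner`.
  have hnorm : ‖w‖ ^ 2 = ν * ‖e‖ ^ 2 := by
    have h := hinner w hw
    rw [hw0, inner_smul_right, inner_self_eq_norm_sq_to_K, inner_self_eq_norm_sq_to_K] at h
    refine Complex.ofReal_injective ?_
    rw [Complex.ofReal_mul, Complex.ofReal_pow, Complex.ofReal_pow]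
    exact h
  have hφn : ‖w none‖ ^ 2 = ν ^ 2 * ‖e‖ ^ 2 := by
    rw [hw0, norm_smul, Complex.norm_real, mul_pow, Real.norm_eq_abs, sq_abs]
  have hepos : 0 < ‖e‖ ^ 2 := pow_pos (norm_pos_iff.2 he) 2
  obtain ⟨C, hC⟩ := exists_poincare_sobolev hd Ω hbdd
  have hP := hC w hw
  have hsplit := norm_jet_sq w
  have hnonneg : 0 ≤ ∑ i, ‖w (some i)‖ ^ 2 := Finset.sum_nonneg fun i _ => sq_nonneg _
  rw [hnorm, hφn] at hsplit
  rw [hφn] at hP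
  generalize ∑ i, ‖w (some i)‖ ^ 2 = S at hP hsplit hnonneg
  generalize ‖e‖ ^ 2 = t at hP hsplit hepos
  have hν2 : 0 < ν ^ 2 := by positivity
  -- With `t = ‖e‖²` and `S` the squared gradient norm of `w`, one has `ν t = ν² t + S`. Poincaré
  -- forces `S > 0`, whence `ν > 0`, and then `ν t (1 - ν) = S` gives `ν < 1`.
  have hS : 0 < S := by
    refine lt_of_le_of_ne hnonneg fun h => ?_
    rw [← h, mul_zero] at hP
    exact absurd hP (not_le.2 (mul_pos hν2 hepos))
  have hνpos : 0 < ν := by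
    have : 0 < ν * t := by rw [hsplit]; positivity
    exact pos_of_mul_pos_left this hepos.le
  refine ⟨hνpos, ?_⟩
  have h1 : 0 < (ν * t) * (1 - ν) := by
    have : ν * t * (1 - ν) = S := by linear_combination hsplit
    rwa [this]
  linarith [pos_of_mul_pos_right h1 (mul_pos hνpos hepos).le]

/-- The nonzero eigenvalues `ν` of the resolvent lie in `(0, 1)`, and `ν⁻¹ - 1` is a Dirichlet
eigenvalue. -/
theorem eigenvalue_resolvent (hd : 1 ≤ d) {Ω : Opens (Euc d)}
    (hbdd : Bornology.IsBounded (Ω : Set (Euc d))) {e : L2 Ω} (he : e ≠ 0) {ν : ℝ} (hν : ν ≠ 0)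
    (heig : resolvent Ω e = (ν : ℂ) • e) :
    ν ∈ Ioo 0 1 ∧ IsDirichletEigenvalue Ω (ν⁻¹ - 1) := by
  have hinner : ∀ v ∈ sobolev Ω, inner ℂ
      (((sobolevEmbedding Ω).adjoint e : sobolev Ω) : JetSpace Ω) v = inner ℂ e (v none) :=
    fun v hv => ContinuousLinearMap.adjoint_inner_left (sobolevEmbedding Ω) ⟨v, hv⟩ e
  exact ⟨mem_Ioo_of_inner hd hbdd he hν (Subtype.prop _) heig hinner,
    isDirichletEigenvalue_of_inner he hν (Subtype.prop _) heig hinner⟩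

/-- `⟨e, Δf⟩ = -λ ⟨e, f⟩` for an eigenvector `e` of the resolvent. -/
theorem inner_laplacian_of_eigenvector {Ω : Opens (Euc d)} {e : L2 Ω} {ν : ℝ} (hν : ν ≠ 0)
    (heig : resolvent Ω e = (ν : ℂ) • e) {f : L2 Ω} (h2 : MemH2 Ω f) (h1 : MemH10 Ω f) :
    inner ℂ e (laplacian Ω f) = -(((ν⁻¹ - 1 : ℝ) : ℂ) * inner ℂ e f) := by
  have hνC : (ν : ℂ) ≠ 0 := by exact_mod_cast hν
  have h := isSymmetric_resolvent Ω e (f - laplacian Ω f)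
  simp only [ContinuousLinearMap.coe_coe] at h
  rw [resolvent_sub_laplacian h2 h1, heig, inner_smul_left, Complex.conj_ofReal,
    inner_sub_right] at h
  push_cast
  field_simp
  linear_combination -h

/-- The numbers `ν⁻¹ - 1` for `ν` a nonzero eigenvalue of the resolvent, i.e. the Dirichlet
eigenvalues reached by the spectral theorem. -/
def spectrumSet (Ω : Opens (Euc d)) : Set ℝ :=
  {lam | ∃ (ν : ℝ) (e : L2 Ω), ν ≠ 0 ∧ e ≠ 0 ∧ resolvent Ω e = (ν : ℂ) • e ∧ lam = ν⁻¹ - 1}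

theorem pos_of_mem_spectrumSet (hd : 1 ≤ d) {Ω : Opens (Euc d)}
    (hbdd : Bornology.IsBounded (Ω : Set (Euc d))) {lam : ℝ} (h : lam ∈ spectrumSet Ω) :
    0 < lam := by
  obtain ⟨ν, e, hν, he, heig, rfl⟩ := h
  obtain ⟨⟨h0, h1⟩, -⟩ := eigenvalue_resolvent hd hbdd he hν heig
  exact sub_pos.2 ((one_lt_inv₀ h0).2 h1)

/-- This inclusion is what carries the non-resonance hypothesis over to the spectral decomposition;
the converse is not needed. -/
theorem isDirichletEigenvalue_of_mem_spectrumSet (hd : 1 ≤ d) {Ω : Opens (Euc d)}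
    (hbdd : Bornology.IsBounded (Ω : Set (Euc d))) {lam : ℝ} (h : lam ∈ spectrumSet Ω) :
    IsDirichletEigenvalue Ω lam := by
  obtain ⟨ν, e, hν, he, heig, rfl⟩ := h
  exact (eigenvalue_resolvent hd hbdd he hν heig).2

/-- A bound `λ ≤ L` keeps `ν = (1 + λ)⁻¹` away from `0`, the only point where the eigenvalues of a
compact operator can accumulate. The relevant `ν` form a compact set, and `ν ↦ ν⁻¹ - 1` is
continuous on it. -/
theorem isCompact_spectrumSet_inter_Iic (hd : 1 ≤ d) {Ω : Opens (Euc d)}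
    (hbdd : Bornology.IsBounded (Ω : Set (Euc d))) (L : ℝ) :
    IsCompact (spectrumSet Ω ∩ Iic L) := by
  -- The absolute value keeps this bound positive for every `L`; surplus eigenvalues are removed by
  -- intersecting the image with `Iic L`.
  have hr : 0 < (1 + |L|)⁻¹ := by positivity
  have hK := isCompact_eigenvalues_Icc (resolvent Ω) (isCompactOperator_resolvent Ω hbdd)
    (s := 1) hr
  have himg := hK.image_of_continuousOn (f := fun ν : ℝ => ν⁻¹ - 1)
    (ContinuousOn.sub (continuousOn_id.inv₀ fun ν hν => (hr.trans_le hν.1.1).ne')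
      continuousOn_const)
  convert himg.inter_right (isClosed_Iic (a := L)) using 1
  ext lam
  simp only [mem_inter_iff, mem_image, mem_ofPred_eq, mem_Iic]
  refine and_congr_left fun hL => ⟨?_, ?_⟩
  · rintro ⟨ν, e, hν, he, heig, rfl⟩
    obtain ⟨⟨h0, h1⟩, -⟩ := eigenvalue_resolvent hd hbdd he hν heig
    refine ⟨ν, ⟨⟨?_, h1.le⟩, e, he, heig⟩, rfl⟩
    rw [inv_le_comm₀ (by positivity) h0]
    linarith [le_abs_self L]
  · rintro ⟨ν, ⟨hν, e, he, heig⟩, rfl⟩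
    exact ⟨ν, e, (hr.trans_le hν.1).ne', he, heig, rfl⟩

/-! ### Spectral coefficients of the solution and conclusion -/

/-- The coefficient of the terminal value of the solution along an eigenvector. -/
theorem inner_solution {Ω : Opens (Euc d)} {a b T : ℝ} (hT : 0 < T) {γ : ℂ} {f : L2 Ω}
    {u : ℝ → L2 Ω}
    (hu : IsSolution Ω a b T (fun t : ℝ => Complex.exp (-γ * (t : ℂ))) f 0 u)
    {e : L2 Ω} {ν : ℝ} (hν : ν ≠ 0) (heig : resolvent Ω e = (ν : ℂ) • e)
    (hne : ((a : ℂ) + b * Complex.I) * ((ν⁻¹ - 1 : ℝ) : ℂ) ≠ γ) :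
    inner ℂ e (u T) =
      duhamel T γ (((a : ℂ) + b * Complex.I) * ((ν⁻¹ - 1 : ℝ) : ℂ)) * inner ℂ e f := by
  obtain ⟨hH2, hH10, hu0, v, ⟨hv, hvu⟩, heq⟩ := hu
  have hvint : IntervalIntegrable v volume 0 T := by
    rw [intervalIntegrable_iff_integrableOn_Ioo_of_le hT.le]
    exact hv.integrable one_le_two
  refine eq_duhamel_mul hT hne (c := fun t => inner ℂ e (u t)) (w := fun t => inner ℂ e (v t))
    ?_ ?_ ?_
  · rw [intervalIntegrable_iff_integrableOn_Ioo_of_le hT.le] at hvint ⊢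
    exact hvint.const_inner e
  · intro t ht
    have hvt : IntervalIntegrable v volume 0 t :=
      hvint.mono_set (by rw [uIcc_of_le ht.1, uIcc_of_le hT.le]; exact Icc_subset_Icc_right ht.2)
    rw [hvu t ht, hu0, zero_add]
    exact ((innerSL ℂ e).intervalIntegral_comp_comm hvt).symm
  · filter_upwards [hH2.1, hH10, heq] with t h2 h1 ht
    have hv' : v t = ((a : ℂ) + (b : ℂ) * Complex.I) • laplacian Ω (u t) +
        Complex.exp (-γ * (t : ℂ)) • f := by rw [← ht]; abel
    rw [hv', inner_add_right, inner_smul_right, inner_smul_right,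
      inner_laplacian_of_eigenvector hν heig h2 h1]
    ring

end CGLE

end

theorem theorem1p1 {d : ℕ} (hd : 1 ≤ d) (Ω : TopologicalSpace.Opens (CGLE.Euc d))
    (hconn : IsConnected (Ω : Set (CGLE.Euc d)))
    (hbdd : Bornology.IsBounded (Ω : Set (CGLE.Euc d)))
    (hbdry : CGLE.HasAnalyticBoundary Ω)
    (a b : ℝ) (ha : 0 < a) (hb : b ≠ 0) (T : ℝ) (hT : 0 < T) (γ : ℂ)
    (hγ : ∀ lam : ℝ, CGLE.IsDirichletEigenvalue Ω lam → ∀ k : ℤ,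
      γ ≠ (a : ℂ) * (lam : ℂ)
        + Complex.I * ((b : ℂ) * (lam : ℂ) - 2 * (k : ℂ) * (Real.pi : ℂ) / (T : ℂ)))
    (M : ℝ) (hM : 0 < M) :
    ∃ C : ℝ, 0 < C ∧ ∀ (f : CGLE.L2 Ω) (u : ℝ → CGLE.L2 Ω),
      CGLE.MemH2 Ω f → CGLE.MemH10 Ω f → CGLE.normH2H10 Ω f ≤ M →
      CGLE.IsSolution Ω a b T (fun t : ℝ => Complex.exp (-γ * (t : ℂ))) f 0 u →
      ‖f‖ ≤ C * M ^ (1 / 2 : ℝ) * ‖u T‖ ^ (1 / 2 : ℝ) := by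
  have hγS : ∀ lam ∈ CGLE.spectrumSet Ω, ∀ k : ℤ, γ ≠ (a : ℂ) * (lam : ℂ)
      + Complex.I * ((b : ℂ) * (lam : ℂ) - 2 * (k : ℂ) * (Real.pi : ℂ) / (T : ℂ)) :=
    fun lam hl => hγ lam (CGLE.isDirichletEigenvalue_of_mem_spectrumSet hd hbdd hl)
  obtain ⟨c, hc, hbound⟩ := CGLE.exists_le_mul_norm_duhamel (b := b) ha hT
    (fun lam => CGLE.pos_of_mem_spectrumSet hd hbdd)
    (CGLE.isCompact_spectrumSet_inter_Iic hd hbdd) hγS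
  refine ⟨√c⁻¹, Real.sqrt_pos.2 (inv_pos.2 hc), fun f u h2 h1 hfM hu => ?_⟩
  have key : ‖f‖ ^ 2 ≤ c⁻¹ * (‖CGLE.laplacian Ω f‖ * ‖u T‖) := by
    refine CGLE.norm_sq_le_of_forall_eigenvector (CGLE.resolvent Ω)
      (CGLE.isCompactOperator_resolvent Ω hbdd) (CGLE.isSymmetric_resolvent Ω)
      (inv_nonneg.2 hc.le) fun e ν he heig => ?_
    -- If `ν = 0`, then `e` is orthogonal to the range of the symmetric resolvent, which contains
    -- `f`, so the coefficient of `f` vanishes.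
    by_cases hν : ν = 0
    · have h := CGLE.isSymmetric_resolvent Ω e (f - CGLE.laplacian Ω f)
      simp only [ContinuousLinearMap.coe_coe] at h
      rw [CGLE.resolvent_sub_laplacian h2 h1, heig, hν, Complex.ofReal_zero, zero_smul,
        inner_zero_left] at h
      rw [← h, norm_zero]
      have := mul_nonneg (inv_nonneg.2 hc.le) (mul_nonneg
        (norm_nonneg (inner ℂ e (CGLE.laplacian Ω f))) (norm_nonneg (inner ℂ e (u T))))
      simpa using this
    · have hmem : ν⁻¹ - 1 ∈ CGLE.spectrumSet Ω := ⟨ν, e, hν, he, heig, rfl⟩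
      have hpos := CGLE.pos_of_mem_spectrumSet hd hbdd hmem
      -- Non-resonance with `k = 0`.
      have hne : ((a : ℂ) + b * Complex.I) * ((ν⁻¹ - 1 : ℝ) : ℂ) ≠ γ := fun h => by
        refine hγS _ hmem 0 ?_
        rw [← h]
        push_cast
        ring
      rw [CGLE.inner_solution hT hu hν heig hne, CGLE.inner_laplacian_of_eigenvector hν heig h2 h1,
        norm_neg, norm_mul, norm_mul, Complex.norm_real, Real.norm_of_nonneg hpos.le,
        inv_mul_eq_div, le_div_iff₀ hc]
      calc ‖inner ℂ e f‖ ^ 2 * c ≤ ‖inner ℂ e f‖ ^ 2 * _ :=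
            mul_le_mul_of_nonneg_left (hbound _ hmem) (sq_nonneg _)
        _ = _ := by ring
  have hle : ‖f‖ ≤ √(c⁻¹ * (M * ‖u T‖)) := by
    refine Real.le_sqrt_of_sq_le (key.trans ?_)
    exact mul_le_mul_of_nonneg_left (mul_le_mul_of_nonneg_right hfM (norm_nonneg _))
      (inv_nonneg.2 hc.le)
  rwa [Real.sqrt_mul (inv_nonneg.2 hc.le), Real.sqrt_mul hM.le, ← mul_assoc,
    Real.sqrt_eq_rpow M, Real.sqrt_eq_rpow ‖u T‖] at hle
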